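/- Let $(\lambda_n)_{n\ge0}$, $(\nu_n)_{n\ge0}$ be real sequences with $\lambda_n\ne\lambda_m$ for $n\ne m$, $\nu_0=\nu_1=0$ and $\nu_n\neq0$ for $n\ge2$, and let $L$ be the linear operator on $\mathbb R[x]$ with $$Lx^n=\lambda_nx^n+\nu_nx^{n-2},\qquad n\ge0 .$$ There is exactly one sequence of monic polynomials $P_n$ with $\deg P_n=n$ and $LP_n=\lambda_nP_n$, and $P_n(-x)=(-1)^nP_n(x)$. A linear functional $\sigma$ on $\mathbb R[x]$ is called nondegenerate if all Hankel determinants $\det(\langle\sigma,x^{i+k}\rangle)_{i,k=0}^n$, $n\ge 0$, are nonzero, and positive definite if $\langle\sigma,p^2\rangle>0$ for every $p\ne0$. The sequence $(P_n)$ is called orthogonal (in the positive-definite sense) if $\langle\sigma,P_nP_m\rangle=0$ for all $n\ne m$, for some nondegenerate (positive definite) $\sigma$. Consider the following families of coefficients ($n=0,1,2,\dots$). Here $\rho,\varepsilon_0,\varepsilon_1$ are free real parameters, $\kappa$ is an overall factor of $L$, and $s$ corresponds to a dilation of $x$. **(i) Generalized little $q$-Jacobi type**, $0<q<1$: $$\lambda_{2n}=\kappa(1-q^{2n})(q^{-2n}+a)+\varepsilon_0,\quad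 \lambda_{2n+1}=\kappa\rho(q^{2n}-1)(q^{-2n}+aq^2)+\varepsilon_1,$$ $$\nu_{2n}=\kappa s(q^{2n}-1)(q^{-2n}+b),\quad \nu_{2n+1}=\kappa s\rho(1-q^{2n})(q^{-2n}+bq^2),$$ and its degenerate case, the **generalized $q$-Laguerre type**, $0<q<1$: $$\lambda_{2n}=\kappa(1-q^{2n})+\varepsilon_0,\quad \lambda_{2n+1}=\kappa\rho(1-q^{2n})+\varepsilon_1,$$ $$\nu_{2n}=-\kappa s(1-q^{2n})(q^{-2n}+b),\quad \nu_{2n+1}=-\kappa s\rho(1-q^{2n})(q^{-2n-2}+b).$$ **(ii) Generalized Gegenbauer type**: $$\lambda_{2n}=-2\kappa n(2n+a)+\varepsilon_0,\quad \lambda_{2n+1}=2\kappa\rho n(2n+a+2)+\varepsilon_1,$$ $$\nu_{2n}=2\kappa s\,n(2n+b),\quad \nu_{2n+1}=-2\kappa s\rho\, n(2n+b+2),$$ and the **generalized Laguerre (generalized Hermite) type**: $$\lambda_{2n}=-2\kappa n+\varepsilon_0,\quad \lambda_{2n+1}=2\kappa\rho n+\varepsilon_1,$$ $$\nu_{2n}=2\kappa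 s\,n(2n+b),\quad \nu_{2n+1}=-2\kappa s\rho\, n(2n+b+2).$$ Then the following hold. 1. **Classification.** The polynomials $P_n$ are orthogonal in the positive-definite sense if and only if $(\lambda_n,\nu_n)$ is of one of these four types for some real parameters with $\kappa\ne0$, $\rho\neq0$, $s>0$, (where $q$ occurs) $0<q<1$, and - $-q^{-2}<b\le0$, $b<a$ (little $q$-Jacobi); - $b>-q^{-2}$ ($q$-Laguerre); - $-2<b<a$ (Gegenbauer); - $b>-2$ (Laguerre). 2. **Recurrence coefficients.** If $(\lambda_n,\nu_n)$ is of one of the four types, for any real parameters (with $0<q<1$ where $q$ occurs), then $P_{n+1}+u_nP_{n-1}=xP_n$ for all $n\ge1$, where, respectively: - (little $q$-Jacobi) $$u_{2n}=s\frac{q^{2n}(1-q^{2n})(aq^{2n-2}-b)}{(1+aq^{4n})(1+aq^{4n-2})},\qquad u_{2n+1}=s\frac{q^{2n}(bq^{2n+2}+1)(aq^{2n}+1)}{(1+aq^{4n})(1+aq^{4n+2})};$$ - ($q$-Laguerre) $$u_{2n}=s\,q^{-4n}(1-q^{2n}),\qquad u_{2n+1}=s\,q^{-4n-2}(1+bq^{2n+2});$$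 - (Gegenbauer) $$u_{2n}=s\frac{2n(2n-2+a-b)}{(a+4n)(a+4n-2)},\qquad u_{2n+1}=s\frac{(2n+a)(2n+2+b)}{(a+4n+2)(a+4n)};$$ - (Laguerre) $$u_{2n}=2sn,\qquad u_{2n+1}=s(2n+2+b).$$ Here in $u_1$ the common factor of numerator and denominator ($1+a$, respectively $a$) is cancelled, so that $u_1=s\frac{1+bq^2}{1+aq^2}$, respectively $u_1=s\frac{2+b}{a+2}$. 3. **No little $-1$ Jacobi class.** If the $P_n$ are orthogonal (with respect to some nondegenerate functional), then neither $(f_n,g_n)=(\lambda_{2n},\nu_{2n})$ nor $(f_n,g_n)=(\lambda_{2n+1},\nu_{2n+1})$ has the form $$f_n=\alpha_1(-1)^n+\alpha_2(-1)^nn+\alpha_0,\qquad g_n=\beta_1(-1)^n+\beta_2(-1)^nn+\beta_0\qquad(n\ge0)$$ with real constants $\alpha_i,\beta_i$. -/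

import Mathlib

open Polynomial

/-- The linear operator `L` on real polynomials acts on monomials by
`L x^n = lam n * x^n + nu n * x^(n-2)`.
For `n = 0, 1` the second term is absent because `nu 0 = nu 1 = 0` is assumed wherever this
predicate is used. -/
def ActsOnMonomials (L : ℝ[X] →ₗ[ℝ] ℝ[X]) (lam nu : ℕ → ℝ) : Prop :=
  ∀ n : ℕ, L (X ^ n) = C (lam n) * X ^ n + C (nu n) * X ^ (n - 2)

/-- `P n` is a monic eigenpolynomial of `L` of degree `n`, with eigenvalue `lam n`, for all `n`. -/
def IsMonicEigenfamily (L : ℝ[X] →ₗ[ℝ] ℝ[X]) (lam : ℕ → ℝ) (P : ℕ → ℝ[X]) : Prop :=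
  ∀ n : ℕ, (P n).Monic ∧ (P n).natDegree = n ∧ L (P n) = C (lam n) * P n

/-- Parity: `P n (-x) = (-1)^n * P n (x)`. -/
def IsSymmetricFamily (P : ℕ → ℝ[X]) : Prop :=
  ∀ n : ℕ, (P n).comp (-X) = (-1) ^ n * P n

/-- Orthogonality of a sequence of polynomials with respect to a moment functional. -/
def IsOrthogonalFor (σ : ℝ[X] →ₗ[ℝ] ℝ) (P : ℕ → ℝ[X]) : Prop :=
  ∀ n m : ℕ, n ≠ m → σ (P n * P m) = 0

/-- A moment functional is nondegenerate if none of its Hankel determinants vanishes. -/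
def IsNondegenerateFunctional (σ : ℝ[X] →ₗ[ℝ] ℝ) : Prop :=
  ∀ n : ℕ, (Matrix.of fun i k : Fin (n + 1) => σ (X ^ ((i : ℕ) + (k : ℕ)))).det ≠ 0

/-- A moment functional is positive definite if `⟨σ, p²⟩ > 0` for every nonzero `p`. -/
def IsPositiveDefiniteFunctional (σ : ℝ[X] →ₗ[ℝ] ℝ) : Prop :=
  ∀ p : ℝ[X], p ≠ 0 → 0 < σ (p * p)

/-- The polynomials are orthogonal for some nondegenerate functional. -/
def IsOPS (P : ℕ → ℝ[X]) : Prop :=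
  ∃ σ : ℝ[X] →ₗ[ℝ] ℝ, IsNondegenerateFunctional σ ∧ IsOrthogonalFor σ P

/-- The polynomials are orthogonal for some positive definite functional. -/
def IsPositiveDefiniteOPS (P : ℕ → ℝ[X]) : Prop :=
  ∃ σ : ℝ[X] →ₗ[ℝ] ℝ, IsPositiveDefiniteFunctional σ ∧ IsOrthogonalFor σ P

/-- The symmetric three-term recurrence `P_{n+1} + u_n P_{n-1} = x P_n` for all `n ≥ 1`, where
`u_{2n} = ue n` (for `n ≥ 1`) and `u_{2n+1} = uo n` (for `n ≥ 0`). -/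
def HasSymmetricRecurrence (P : ℕ → ℝ[X]) (ue uo : ℕ → ℝ) : Prop :=
  (∀ n : ℕ, 1 ≤ n → P (2 * n + 1) + C (ue n) * P (2 * n - 1) = X * P (2 * n)) ∧
  (∀ n : ℕ, P (2 * n + 2) + C (uo n) * P (2 * n) = X * P (2 * n + 1))

/-- The generalized little `q`-Jacobi coefficients. The real numbers `ρ, ε₀, ε₁` are free; `κ` is
a common factor of the operator, and `s` comes from a dilation of the variable. -/
def IsLittleQJacobiType (lam nu : ℕ → ℝ) (q a b s κ ρ ε₀ ε₁ : ℝ) : Prop :=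
  ∀ n : ℕ,
    lam (2 * n) = κ * ((1 - q ^ (2 * n)) * ((q ^ (2 * n))⁻¹ + a)) + ε₀ ∧
    lam (2 * n + 1) = κ * (ρ * (q ^ (2 * n) - 1) * ((q ^ (2 * n))⁻¹ + a * q ^ 2)) + ε₁ ∧
    nu (2 * n) = κ * s * ((q ^ (2 * n) - 1) * ((q ^ (2 * n))⁻¹ + b)) ∧
    nu (2 * n + 1) = κ * s * (ρ * (1 - q ^ (2 * n)) * ((q ^ (2 * n))⁻¹ + b * q ^ 2))

/-- The generalized `q`-Laguerre coefficients (a degenerate case of the previous ones). -/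
def IsQLaguerreType (lam nu : ℕ → ℝ) (q b s κ ρ ε₀ ε₁ : ℝ) : Prop :=
  ∀ n : ℕ,
    lam (2 * n) = κ * (1 - q ^ (2 * n)) + ε₀ ∧
    lam (2 * n + 1) = κ * (ρ * (1 - q ^ (2 * n))) + ε₁ ∧
    nu (2 * n) = κ * s * ((q ^ (2 * n) - 1) * ((q ^ (2 * n))⁻¹ + b)) ∧
    nu (2 * n + 1) = κ * s * (ρ * (q ^ (2 * n) - 1) * ((q ^ (2 * n + 2))⁻¹ + b))

/-- The generalized Gegenbauer coefficients (Jacobi class). -/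
def IsJacobiType (lam nu : ℕ → ℝ) (a b s κ ρ ε₀ ε₁ : ℝ) : Prop :=
  ∀ n : ℕ,
    lam (2 * n) = κ * (-(2 * n) * (2 * n + a)) + ε₀ ∧
    lam (2 * n + 1) = κ * (2 * ρ * n * (2 * n + a + 2)) + ε₁ ∧
    nu (2 * n) = κ * s * (2 * n * (2 * n + b)) ∧
    nu (2 * n + 1) = κ * s * (-(2 * ρ * n) * (2 * n + b + 2))

/-- The generalized Laguerre (generalized Hermite) coefficients. -/
def IsLaguerreType (lam nu : ℕ → ℝ) (b s κ ρ ε₀ ε₁ : ℝ) : Prop :=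
  ∀ n : ℕ,
    lam (2 * n) = κ * (-(2 * n)) + ε₀ ∧
    lam (2 * n + 1) = κ * (2 * ρ * n) + ε₁ ∧
    nu (2 * n) = κ * s * (2 * n * (2 * n + b)) ∧
    nu (2 * n + 1) = κ * s * (-(2 * ρ * n) * (2 * n + b + 2))

/-- The little `-1` Jacobi form of a pair of coefficient sequences. -/
def IsLittleNegOneJacobiForm (f g : ℕ → ℝ) : Prop :=
  ∃ α₀ α₁ α₂ β₀ β₁ β₂ : ℝ, ∀ n : ℕ,
    f n = α₁ * (-1) ^ n + α₂ * (-1) ^ n * n + α₀ ∧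
    g n = β₁ * (-1) ^ n + β₂ * (-1) ^ n * n + β₀

/-- `u_{2n}` for the generalized little `q`-Jacobi polynomials. -/
noncomputable def uQJacobiEven (q a b : ℝ) (n : ℕ) : ℝ :=
  q ^ (2 * n) * (1 - q ^ (2 * n)) * (a * q ^ (2 * n - 2) - b) /
    ((1 + a * q ^ (4 * n)) * (1 + a * q ^ (4 * n - 2)))

/-- `u_{2n+1}` for the generalized little `q`-Jacobi polynomials; for `n = 0` the common factor
`1 + a` of numerator and denominator, which may vanish, is cancelled. -/
noncomputable def uQJacobiOdd (q a b : ℝ) (n : ℕ) : ℝ :=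
  if n = 0 then (b * q ^ 2 + 1) / (1 + a * q ^ 2)
  else q ^ (2 * n) * (b * q ^ (2 * n + 2) + 1) * (a * q ^ (2 * n) + 1) /
    ((1 + a * q ^ (4 * n)) * (1 + a * q ^ (4 * n + 2)))

/-- `u_{2n}` for the generalized `q`-Laguerre polynomials. -/
noncomputable def uQLaguerreEven (q : ℝ) (n : ℕ) : ℝ :=
  (1 - q ^ (2 * n)) / q ^ (4 * n)

/-- `u_{2n+1}` for the generalized `q`-Laguerre polynomials. -/
noncomputable def uQLaguerreOdd (q b : ℝ) (n : ℕ) : ℝ :=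
  (1 + b * q ^ (2 * n + 2)) / q ^ (4 * n + 2)

/-- `u_{2n}` for the generalized Gegenbauer polynomials. -/
noncomputable def uJacobiEven (a b : ℝ) (n : ℕ) : ℝ :=
  2 * n * (2 * n - 2 + a - b) / ((a + 4 * n) * (a + 4 * n - 2))

/-- `u_{2n+1}` for the generalized Gegenbauer polynomials; for `n = 0` the common factor `a` of
numerator and denominator, which may vanish, is cancelled. -/
noncomputable def uJacobiOdd (a b : ℝ) (n : ℕ) : ℝ :=
  if n = 0 then (2 + b) / (a + 2)
  else (2 * n + a) * (2 * n + 2 + b) / ((a + 4 * n + 2) * (a + 4 * n))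

/-- `u_{2n}` for the generalized Laguerre polynomials. -/
def uLaguerreEven (n : ℕ) : ℝ := 2 * n

/-- `u_{2n+1}` for the generalized Laguerre polynomials. -/
def uLaguerreOdd (b : ℝ) (n : ℕ) : ℝ := 2 * n + 2 + b

/-! Write `c_k = ⟨σ, x^k⟩`, `t_k = c_{2k+2} / c_{2k}`, and let `D`, `N` be the sequences `bracketLin
θ d₀ d₁`, `bracketLin θ n₀ n₁`.

Orthogonality makes `L` symmetric for the form `⟨σ, p r⟩`. On monomials this says `(λ_n - λ_m)
c_{n+m} + (ν_n - ν_m) c_{n+m-2} = 0`. So the chord between the points `(λ_{2i}, ν_{2i})` and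
`(λ_{2j}, ν_{2j})` has slope `-t_{i+j-1}`, and for the odd indices `2i+1`, `2j+1` it is `-t_{i+j}`.

Necessity: positivity makes `t` strictly increasing. Eliminating `t` shows that `λ_{2n}` and
`ν_{2n}` obey the same recurrence with one constant `y` (`exists_difference_relation`). Monotonicity
forbids oscillation, so `y = θ + θ⁻¹` with `0 < θ ≤ 1`, and the odd coefficients follow from the
even ones up to a factor and constants (`exists_odd_proportional`). This is `IsBracketType`. The
four families are `θ < 1` or `θ = 1`, with `D` generic or degenerate. The parameter bounds come from
the sign, growth and limit of `t`, except `b ≤ 0`, which comes from `u_{2n} > 0` as `n → ∞`.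

Recurrence and sufficiency: for bracket type the eigenvalue differences factor (`lam_even_sub`,
`lam_odd_sub`), hence polynomials of neighbouring degrees have proportional coefficients and the
three-term recurrence can be checked coefficient by coefficient. Positivity of `u` then gives a
positive definite functional by Favard's theorem.

The little `-1` Jacobi form, already on four points, forces `t_0 = t_1`, against the third Hankel
determinant. -/

/-! ### Existence, uniqueness and parity of the eigenpolynomials -/

section Eigenfamily

variable {L : ℝ[X] →ₗ[ℝ] ℝ[X]} {lam nu : ℕ → ℝ} {P : ℕ → ℝ[X]}

theorem ActsOnMonomials.coeff_apply (hL : ActsOnMonomials L lam nu) (hnu0 : nu 0 = 0)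
    (hnu1 : nu 1 = 0) (p : ℝ[X]) (m : ℕ) :
    (L p).coeff m = lam m * p.coeff m + nu (m + 2) * p.coeff (m + 2) := by
  induction p using Polynomial.induction_on' with
  | add p q hp hq => simp only [map_add, coeff_add, hp, hq]; ring
  | monomial n a =>
    have h : (monomial n a : ℝ[X]) = a • X ^ n := by
      rw [smul_X_eq_monomial]
    rw [h, map_smul, hL n]
    simp only [coeff_smul, coeff_add, coeff_C_mul, coeff_X_pow, smul_eq_mul]
    rcases n with _ | _ | n
    · rw [hnu0, if_neg (show m + 2 ≠ 0 by omega)]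
      split_ifs with h1
      · subst h1; ring
      · ring
    · rw [hnu1, if_neg (show m + 2 ≠ 0 + 1 by omega)]
      by_cases h1 : m = 0 + 1
      · rw [if_pos h1, h1]; ring
      · rw [if_neg h1]; ring
    · have e1 : (m = n + 1 + 1 - 2) ↔ (m + 2 = n + 1 + 1) := by omega
      simp only [e1]
      by_cases h1 : m + 2 = n + 1 + 1
      · rw [if_pos h1, if_neg (by omega), h1]; ring
      · rw [if_neg h1]
        by_cases h2 : m = n + 1 + 1
        · rw [if_pos h2, h2]; ring
        · rw [if_neg h2]; ring

theorem IsMonicEigenfamily.coeff_rec (hP : IsMonicEigenfamily L lam P)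
    (hL : ActsOnMonomials L lam nu) (hnu0 : nu 0 = 0) (hnu1 : nu 1 = 0) (n m : ℕ) :
    (lam n - lam m) * (P n).coeff m = nu (m + 2) * (P n).coeff (m + 2) := by
  have h := congrArg (fun p => p.coeff m) (hP n).2.2
  simp only [hL.coeff_apply hnu0 hnu1, coeff_C_mul] at h
  linear_combination -h

theorem IsMonicEigenfamily.coeff_self (hP : IsMonicEigenfamily L lam P) (n : ℕ) :
    (P n).coeff n = 1 := by
  have h := (hP n).1
  rw [Monic, leadingCoeff, (hP n).2.1] at h
  exact h

theorem IsMonicEigenfamily.coeff_of_lt (hP : IsMonicEigenfamily L lam P) {n m : ℕ} (h : n < m) :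
    (P n).coeff m = 0 :=
  coeff_eq_zero_of_natDegree_lt (by rw [(hP n).2.1]; exact h)

/-- The two-step recursion starts just above the degree, where the coefficient is zero, and distinct
eigenvalues propagate the zero downwards. -/
theorem IsMonicEigenfamily.coeff_odd (hP : IsMonicEigenfamily L lam P)
    (hL : ActsOnMonomials L lam nu) (hlam : ∀ n m : ℕ, n ≠ m → lam n ≠ lam m)
    (hnu0 : nu 0 = 0) (hnu1 : nu 1 = 0) (m k : ℕ) :
    (P (m + 2 * k + 1)).coeff m = 0 := by
  induction k generalizing m with
  | zero =>
    have h := hP.coeff_rec hL hnu0 hnu1 (m + 1) m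
    rw [hP.coeff_of_lt (show m + 1 < m + 2 by omega), mul_zero] at h
    exact (mul_eq_zero.1 h).resolve_left (sub_ne_zero.2 (hlam _ _ (by omega)))
  | succ k ih =>
    have h := hP.coeff_rec hL hnu0 hnu1 (m + 2 * (k + 1) + 1) m
    have e : m + 2 * (k + 1) + 1 = m + 2 + 2 * k + 1 := by ring
    rw [e, ih (m + 2), mul_zero] at h
    rw [e]
    exact (mul_eq_zero.1 h).resolve_left (sub_ne_zero.2 (hlam _ _ (by omega)))

theorem IsMonicEigenfamily.coeff_eq_zero_of_odd_add (hP : IsMonicEigenfamily L lam P)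
    (hL : ActsOnMonomials L lam nu) (hlam : ∀ n m : ℕ, n ≠ m → lam n ≠ lam m)
    (hnu0 : nu 0 = 0) (hnu1 : nu 1 = 0) {n m : ℕ} (h : (n + m) % 2 = 1) :
    (P n).coeff m = 0 := by
  rcases lt_or_ge n m with hlt | hle
  · exact hP.coeff_of_lt hlt
  · obtain ⟨k, rfl⟩ : ∃ k, n = m + 2 * k + 1 := ⟨(n - m) / 2, by omega⟩
    exact hP.coeff_odd hL hlam hnu0 hnu1 m k

theorem IsMonicEigenfamily.symmetric (hP : IsMonicEigenfamily L lam P)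
    (hL : ActsOnMonomials L lam nu) (hlam : ∀ n m : ℕ, n ≠ m → lam n ≠ lam m)
    (hnu0 : nu 0 = 0) (hnu1 : nu 1 = 0) : IsSymmetricFamily P := by
  intro n
  ext m
  have e : ((-1 : ℝ[X]) ^ n) = C ((-1 : ℝ) ^ n) := by simp
  have e' : (-X : ℝ[X]) = C (-1 : ℝ) * X := by simp
  rw [e', comp_C_mul_X_coeff, e, coeff_C_mul, mul_comm]
  rcases Nat.mod_two_eq_zero_or_one (n + m) with h | h
  · congr 1
    have : Even (n + m) := Nat.even_iff.2 h
    rcases Nat.even_or_odd n with hn | hn <;> rcases Nat.even_or_odd m with hm | hm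
    · rw [hn.neg_one_pow, hm.neg_one_pow]
    · exact absurd this (Nat.not_even_iff_odd.2 (hn.add_odd hm))
    · exact absurd this (Nat.not_even_iff_odd.2 (hn.add_even hm))
    · rw [hn.neg_one_pow, hm.neg_one_pow]
  · rw [hP.coeff_eq_zero_of_odd_add hL hlam hnu0 hnu1 h, mul_zero, mul_zero]

theorem IsMonicEigenfamily.coeff_unique {Q : ℕ → ℝ[X]} (hP : IsMonicEigenfamily L lam P)
    (hQ : IsMonicEigenfamily L lam Q)
    (hL : ActsOnMonomials L lam nu) (hlam : ∀ n m : ℕ, n ≠ m → lam n ≠ lam m)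
    (hnu0 : nu 0 = 0) (hnu1 : nu 1 = 0) (m k : ℕ) :
    (P (m + 2 * k)).coeff m = (Q (m + 2 * k)).coeff m := by
  induction k generalizing m with
  | zero => simp [hP.coeff_self, hQ.coeff_self]
  | succ k ih =>
    have h := hP.coeff_rec hL hnu0 hnu1 (m + 2 * (k + 1)) m
    have h' := hQ.coeff_rec hL hnu0 hnu1 (m + 2 * (k + 1)) m
    have e : m + 2 * (k + 1) = m + 2 + 2 * k := by ring
    rw [e, ih (m + 2)] at h
    rw [e, ← h] at h'
    rw [e]
    exact (mul_left_cancel₀ (sub_ne_zero.2 (hlam _ _ (by omega))) h').symm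

theorem IsMonicEigenfamily.unique {Q : ℕ → ℝ[X]} (hP : IsMonicEigenfamily L lam P)
    (hQ : IsMonicEigenfamily L lam Q)
    (hL : ActsOnMonomials L lam nu) (hlam : ∀ n m : ℕ, n ≠ m → lam n ≠ lam m)
    (hnu0 : nu 0 = 0) (hnu1 : nu 1 = 0) : P = Q := by
  ext n m
  rcases Nat.mod_two_eq_zero_or_one (n + m) with h | h
  · rcases lt_or_ge n m with hlt | hle
    · rw [hP.coeff_of_lt hlt, hQ.coeff_of_lt hlt]
    · obtain ⟨k, rfl⟩ : ∃ k, n = m + 2 * k := ⟨(n - m) / 2, by omega⟩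
      exact hP.coeff_unique hQ hL hlam hnu0 hnu1 m k
  · rw [hP.coeff_eq_zero_of_odd_add hL hlam hnu0 hnu1 h,
      hQ.coeff_eq_zero_of_odd_add hL hlam hnu0 hnu1 h]

/-- The coefficient of `x ^ (n - i)` in the monic eigenpolynomial of degree `n`. -/
noncomputable def eigenCoeff (lam nu : ℕ → ℝ) (n : ℕ) : ℕ → ℝ
  | 0 => 1
  | 1 => 0
  | i + 2 => nu (n - i) / (lam n - lam (n - i - 2)) * eigenCoeff lam nu n i

/-- The monic eigenpolynomial of degree `n`. -/
noncomputable def eigenPoly (lam nu : ℕ → ℝ) (n : ℕ) : ℝ[X] :=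
  ∑ i ∈ Finset.range (n + 1), C (eigenCoeff lam nu n (n - i)) * X ^ i

theorem eigenPoly_coeff (lam nu : ℕ → ℝ) (n m : ℕ) :
    (eigenPoly lam nu n).coeff m = if m ≤ n then eigenCoeff lam nu n (n - m) else 0 := by
  simp [eigenPoly, coeff_X_pow]

theorem eigenPoly_isMonicEigenfamily (hL : ActsOnMonomials L lam nu)
    (hlam : ∀ n m : ℕ, n ≠ m → lam n ≠ lam m) (hnu0 : nu 0 = 0) (hnu1 : nu 1 = 0) :
    IsMonicEigenfamily L lam (eigenPoly lam nu) := by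
  intro n
  have hc : (eigenPoly lam nu n).coeff n = 1 := by simp [eigenPoly_coeff, eigenCoeff]
  have hd : (eigenPoly lam nu n).natDegree ≤ n := by
    rw [natDegree_le_iff_coeff_eq_zero]
    intro m hm
    rw [eigenPoly_coeff, if_neg (by omega)]
  refine ⟨monic_of_natDegree_le_of_coeff_eq_one n hd hc, ?_, ?_⟩
  · exact natDegree_eq_of_le_of_coeff_ne_zero hd (by rw [hc]; exact one_ne_zero)
  · ext m
    rw [hL.coeff_apply hnu0 hnu1, coeff_C_mul, eigenPoly_coeff, eigenPoly_coeff]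
    rcases lt_trichotomy (m + 1) n with h | h | h
    · obtain ⟨i, rfl⟩ : ∃ i, n = m + 2 + i := ⟨n - m - 2, by omega⟩
      rw [if_pos (by omega), if_pos (by omega), show m + 2 + i - m = i + 2 by omega,
        show m + 2 + i - (m + 2) = i by omega, eigenCoeff, show m + 2 + i - i = m + 2 by omega,
        show m + 2 - 2 = m by omega]
      have := sub_ne_zero.2 (hlam (m + 2 + i) m (by omega))
      field_simp
      ring
    · subst h
      simp [eigenCoeff]
    · rcases Nat.lt_or_ge n m with h' | h'
      · rw [if_neg (by omega), if_neg (by omega)]; ring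
      · obtain rfl : n = m := by omega
        simp [eigenCoeff]

theorem existsUnique_isMonicEigenfamily (hL : ActsOnMonomials L lam nu)
    (hlam : ∀ n m : ℕ, n ≠ m → lam n ≠ lam m) (hnu0 : nu 0 = 0) (hnu1 : nu 1 = 0) :
    ∃! P : ℕ → ℝ[X], IsMonicEigenfamily L lam P :=
  ⟨eigenPoly lam nu, eigenPoly_isMonicEigenfamily hL hlam hnu0 hnu1, fun _ hQ =>
    hQ.unique (eigenPoly_isMonicEigenfamily hL hlam hnu0 hnu1) hL hlam hnu0 hnu1⟩

end Eigenfamily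

/-! ### The common form of the four families and its three-term recurrence -/

section BracketType

/-- The bracket `[n] = 1 + θ + ⋯ + θ ^ (n - 1)`. -/
def bracket (θ : ℝ) (n : ℕ) : ℝ := ∑ i ∈ Finset.range n, θ ^ i

@[simp] theorem bracket_zero (θ : ℝ) : bracket θ 0 = 0 := by simp [bracket]

theorem bracket_succ (θ : ℝ) (n : ℕ) : bracket θ (n + 1) = bracket θ n + θ ^ n :=
  Finset.sum_range_succ _ _

@[simp] theorem bracket_one_right (θ : ℝ) : bracket θ 1 = 1 := by simp [bracket]

theorem one_sub_mul_bracket (θ : ℝ) (n : ℕ) : (1 - θ) * bracket θ n = 1 - θ ^ n := by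
  induction n with
  | zero => simp
  | succ n ih => rw [bracket_succ, mul_add, ih]; ring

theorem pow_eq_bracket (θ : ℝ) (n : ℕ) : θ ^ n = 1 - (1 - θ) * bracket θ n := by
  rw [one_sub_mul_bracket]; ring

theorem bracket_add (θ : ℝ) (m n : ℕ) :
    bracket θ (m + n) = bracket θ m + θ ^ m * bracket θ n := by
  simp [bracket, Finset.sum_range_add, Finset.mul_sum, pow_add]

theorem bracket_pos {θ : ℝ} (hθ : 0 < θ) {n : ℕ} (hn : n ≠ 0) : 0 < bracket θ n :=
  Finset.sum_pos (fun i _ => pow_pos hθ i) (Finset.nonempty_range_iff.2 hn)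

theorem bracket_ne_zero {θ : ℝ} (hθ : 0 < θ) {n : ℕ} (hn : n ≠ 0) : bracket θ n ≠ 0 :=
  (bracket_pos hθ hn).ne'

theorem bracket_one_left (n : ℕ) : bracket 1 n = n := by simp [bracket]

/-- The sequence `d₀ + d₁ [n]`. -/
def bracketLin (θ d₀ d₁ : ℝ) (n : ℕ) : ℝ := d₀ + d₁ * bracket θ n

/-- The coefficients common to all four families: `θ = q ^ 2` for the `q`-families and `θ = 1` for
the other two. -/
def IsBracketType (lam nu : ℕ → ℝ) (θ d₀ d₁ n₀ n₁ ρ ε₀ ε₁ : ℝ) : Prop :=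
  ∀ n : ℕ,
    lam (2 * n) = (θ ^ n)⁻¹ * bracket θ n * bracketLin θ d₀ d₁ n + ε₀ ∧
    lam (2 * n + 1) = -ρ * ((θ ^ n)⁻¹ * bracket θ n * bracketLin θ d₀ d₁ (n + 1)) + ε₁ ∧
    nu (2 * n) = -((θ ^ n)⁻¹ * bracket θ n * bracketLin θ n₀ n₁ n) ∧
    nu (2 * n + 1) = ρ * ((θ ^ n)⁻¹ * bracket θ n * bracketLin θ n₀ n₁ (n + 1))

/-- `u_{2n}` for coefficients of bracket type. -/
noncomputable def uBracketEven (θ d₀ d₁ n₀ n₁ : ℝ) (n : ℕ) : ℝ :=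
  bracket θ n * (bracketLin θ n₀ n₁ (n + 1) / bracketLin θ d₀ d₁ (2 * n) -
    bracketLin θ n₀ n₁ n / bracketLin θ d₀ d₁ (2 * n - 1))

/-- `u_{2n+1}` for coefficients of bracket type. -/
noncomputable def uBracketOdd (θ d₀ d₁ n₀ n₁ : ℝ) (n : ℕ) : ℝ :=
  if n = 0 then bracketLin θ n₀ n₁ 1 / bracketLin θ d₀ d₁ 1
  else θ ^ n * bracketLin θ n₀ n₁ (n + 1) * bracketLin θ d₀ d₁ n /
    (bracketLin θ d₀ d₁ (2 * n) * bracketLin θ d₀ d₁ (2 * n + 1))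

variable {lam nu : ℕ → ℝ} {θ d₀ d₁ n₀ n₁ ρ ε₀ ε₁ : ℝ}

namespace IsBracketType

/-- The sequence combines `1, θ^n, θ^{-n}` (at `θ = 1`: `1, n, n²`). Such a difference splits into a
factor in the difference of the indices and one in their sum. -/
theorem lam_even_sub (h : IsBracketType lam nu θ d₀ d₁ n₀ n₁ ρ ε₀ ε₁) (hθ : 0 < θ) (m k : ℕ) :
    lam (2 * (m + k)) - lam (2 * m) =
      (θ ^ (m + k))⁻¹ * bracket θ k * bracketLin θ d₀ d₁ (2 * m + k) := by
  rw [(h (m + k)).1, (h m).1]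
  have h1 := pow_ne_zero m hθ.ne'
  have h2 := pow_ne_zero k hθ.ne'
  simp only [bracketLin, two_mul, add_assoc m m k, bracket_add, pow_add]
  field_simp
  simp only [pow_eq_bracket θ]
  ring

theorem lam_odd_sub (h : IsBracketType lam nu θ d₀ d₁ n₀ n₁ ρ ε₀ ε₁) (hθ : 0 < θ) (m k : ℕ) :
    lam (2 * (m + k) + 1) - lam (2 * m + 1) =
      -ρ * ((θ ^ (m + k))⁻¹ * bracket θ k * bracketLin θ d₀ d₁ (2 * m + k + 1)) := by
  rw [(h (m + k)).2.1, (h m).2.1]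
  have h1 := pow_ne_zero m hθ.ne'
  have h2 := pow_ne_zero k hθ.ne'
  simp only [bracketLin, two_mul, add_assoc m m k, bracket_add, pow_add, bracket_succ,
    add_assoc]
  field_simp
  simp only [pow_eq_bracket θ]
  ring

/-- Comparison with index 0, where the bracket vanishes. Nothing is gained for `k = 0`: `D(0)` may
be zero, which is why `u_1` needs separate treatment. -/
theorem den_ne_zero (h : IsBracketType lam nu θ d₀ d₁ n₀ n₁ ρ ε₀ ε₁)
    (hlam : ∀ n m : ℕ, n ≠ m → lam n ≠ lam m) {k : ℕ} (hk : k ≠ 0) :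
    bracketLin θ d₀ d₁ k ≠ 0 := by
  intro h0
  apply hlam (2 * k) (2 * 0) (by omega)
  rw [(h k).1, (h 0).1, h0]
  simp

theorem num_ne_zero (h : IsBracketType lam nu θ d₀ d₁ n₀ n₁ ρ ε₀ ε₁)
    (hnu : ∀ n : ℕ, 2 ≤ n → nu n ≠ 0) {k : ℕ} (hk : k ≠ 0) :
    bracketLin θ n₀ n₁ k ≠ 0 := by
  intro h0
  apply hnu (2 * k) (by omega)
  rw [(h k).2.2.1, h0]
  simp

theorem rho_ne_zero (h : IsBracketType lam nu θ d₀ d₁ n₀ n₁ ρ ε₀ ε₁)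
    (hnu : ∀ n : ℕ, 2 ≤ n → nu n ≠ 0) : ρ ≠ 0 := by
  intro h0
  apply hnu (2 * 1 + 1) (by omega)
  rw [(h 1).2.2.2, h0]
  simp

variable {L : ℝ[X] →ₗ[ℝ] ℝ[X]} {P : ℕ → ℝ[X]}

theorem coeff_even_rec (h : IsBracketType lam nu θ d₀ d₁ n₀ n₁ ρ ε₀ ε₁) (hθ : 0 < θ)
    (hrec : ∀ n m, (lam n - lam m) * (P n).coeff m = nu (m + 2) * (P n).coeff (m + 2)) (m k : ℕ) :
    bracket θ k * bracketLin θ d₀ d₁ (2 * m + k) * (P (2 * (m + k))).coeff (2 * m) * θ =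
      -(θ ^ k * bracket θ (m + 1) * bracketLin θ n₀ n₁ (m + 1) *
        (P (2 * (m + k))).coeff (2 * (m + 1))) := by
  have e := hrec (2 * (m + k)) (2 * m)
  rw [h.lam_even_sub hθ, show 2 * m + 2 = 2 * (m + 1) by ring, (h (m + 1)).2.2.1] at e
  have h1 := pow_ne_zero m hθ.ne'
  have h2 := pow_ne_zero k hθ.ne'
  rw [pow_add, pow_succ] at e
  field_simp at e
  linear_combination e

theorem coeff_odd_rec (h : IsBracketType lam nu θ d₀ d₁ n₀ n₁ ρ ε₀ ε₁) (hθ : 0 < θ) (hρ : ρ ≠ 0)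
    (hrec : ∀ n m, (lam n - lam m) * (P n).coeff m = nu (m + 2) * (P n).coeff (m + 2)) (m k : ℕ) :
    bracket θ k * bracketLin θ d₀ d₁ (2 * m + k + 1) *
        (P (2 * (m + k) + 1)).coeff (2 * m + 1) * θ =
      -(θ ^ k * bracket θ (m + 1) * bracketLin θ n₀ n₁ (m + 2) *
        (P (2 * (m + k) + 1)).coeff (2 * (m + 1) + 1)) := by
  have e := hrec (2 * (m + k) + 1) (2 * m + 1)
  rw [h.lam_odd_sub hθ, show 2 * m + 1 + 2 = 2 * (m + 1) + 1 by ring, (h (m + 1)).2.2.2] at e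
  have h1 := pow_ne_zero m hθ.ne'
  have h2 := pow_ne_zero k hθ.ne'
  rw [pow_add, pow_succ] at e
  field_simp at e
  linear_combination -e

/-- Both coefficient recursions have factored terms, so their quotient telescopes from the leading
coefficients (`k = 0`) downwards. The relation is stated without division because `D(0)` may vanish.
-/
theorem coeff_odd_of_even (h : IsBracketType lam nu θ d₀ d₁ n₀ n₁ ρ ε₀ ε₁) (hθ : 0 < θ)
    (hρ : ρ ≠ 0) (hD : ∀ k, k ≠ 0 → bracketLin θ d₀ d₁ k ≠ 0)
    (hrec : ∀ n m, (lam n - lam m) * (P n).coeff m = nu (m + 2) * (P n).coeff (m + 2))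
    (hone : ∀ n, (P n).coeff n = 1) (m k : ℕ) :
    bracketLin θ n₀ n₁ (m + 1) * bracketLin θ d₀ d₁ (2 * (m + k)) *
        (P (2 * (m + k) + 1)).coeff (2 * m + 1) =
      bracketLin θ d₀ d₁ (2 * m + k) * bracketLin θ n₀ n₁ (m + k + 1) *
        (P (2 * (m + k))).coeff (2 * m) := by
  induction k generalizing m with
  | zero => simp only [add_zero, hone]; ring
  | succ k ih =>
    have e0 := ih (m + 1)
    have e1 := h.coeff_even_rec hθ hrec m (k + 1)
    have e2 := h.coeff_odd_rec hθ hρ hrec m (k + 1)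
    rw [show m + 1 + k = m + (k + 1) by ring, show 2 * (m + 1) + k = 2 * m + (k + 1) + 1 by ring,
      show m + 1 + 1 = m + 2 by ring] at e0
    have hb := bracket_ne_zero hθ (Nat.succ_ne_zero k)
    have hd := hD (2 * m + (k + 1) + 1) (by omega)
    have := mul_ne_zero (mul_ne_zero hb hd) hθ.ne'
    apply mul_left_cancel₀ this
    linear_combination bracketLin θ n₀ n₁ (m + 1) * bracketLin θ d₀ d₁ (2 * (m + (k + 1))) * e2
      - bracketLin θ d₀ d₁ (2 * m + (k + 1) + 1) * bracketLin θ n₀ n₁ (m + (k + 1) + 1) * e1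
      - θ ^ (k + 1) * bracket θ (m + 1) * bracketLin θ n₀ n₁ (m + 1) * e0

theorem coeff_even_of_odd (h : IsBracketType lam nu θ d₀ d₁ n₀ n₁ ρ ε₀ ε₁) (hθ : 0 < θ)
    (hρ : ρ ≠ 0) (hD : ∀ k, k ≠ 0 → bracketLin θ d₀ d₁ k ≠ 0)
    (hrec : ∀ n m, (lam n - lam m) * (P n).coeff m = nu (m + 2) * (P n).coeff (m + 2))
    (hone : ∀ n, (P n).coeff n = 1) (m k : ℕ) :
    bracketLin θ d₀ d₁ (2 * (m + k) + 1) * bracket θ (m + 1) *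
        (P (2 * (m + k + 1))).coeff (2 * (m + 1)) =
      bracketLin θ d₀ d₁ (2 * m + k + 1) * bracket θ (m + k + 1) *
        (P (2 * (m + k) + 1)).coeff (2 * m + 1) := by
  induction k generalizing m with
  | zero => simp only [add_zero, hone]
  | succ k ih =>
    have e0 := ih (m + 1)
    have e1 := h.coeff_even_rec hθ hrec (m + 1) (k + 1)
    have e2 := h.coeff_odd_rec hθ hρ hrec m (k + 1)
    rw [show m + 1 + k = m + (k + 1) by ring, show 2 * (m + 1) + k + 1 = 2 * m + (k + 1) + 2 by ring,
      show m + 1 + 1 = m + 2 by ring] at e0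
    rw [show 2 * (m + 1) + (k + 1) = 2 * m + (k + 1) + 2 by ring,
      show m + 1 + (k + 1) = m + (k + 1) + 1 by ring, show m + 1 + 1 = m + 2 by ring] at e1
    have hb := bracket_ne_zero hθ (Nat.succ_ne_zero k)
    have hd := hD (2 * m + (k + 1) + 2) (by omega)
    have := mul_ne_zero (mul_ne_zero hb hd) hθ.ne'
    apply mul_left_cancel₀ this
    linear_combination bracketLin θ d₀ d₁ (2 * (m + (k + 1)) + 1) * bracket θ (m + 1) * e1
      - bracketLin θ d₀ d₁ (2 * m + (k + 1) + 2) * bracket θ (m + (k + 1) + 1) * e2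
      - θ ^ (k + 1) * bracket θ (m + 1) * bracketLin θ n₀ n₁ (m + 2) * e0

/-- The coefficients of even powers in `P_{2N+2} + u_{2N+1} P_{2N} = x P_{2N+1}`. -/
theorem coeff_recurrence_odd (h : IsBracketType lam nu θ d₀ d₁ n₀ n₁ ρ ε₀ ε₁) (hθ : 0 < θ)
    (hρ : ρ ≠ 0) (hD : ∀ k, k ≠ 0 → bracketLin θ d₀ d₁ k ≠ 0)
    (hrec : ∀ n m, (lam n - lam m) * (P n).coeff m = nu (m + 2) * (P n).coeff (m + 2))
    (hone : ∀ n, (P n).coeff n = 1) (m k : ℕ) :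
    (P (2 * (m + k + 1))).coeff (2 * m) +
        uBracketOdd θ d₀ d₁ n₀ n₁ (m + k) * (P (2 * (m + k))).coeff (2 * m) =
      (X * P (2 * (m + k) + 1)).coeff (2 * m) := by
  have e3 := h.coeff_even_rec hθ hrec m (k + 1)
  rw [show m + (k + 1) = m + k + 1 by ring] at e3
  have hD1 := hD (2 * m + (k + 1)) (by omega)
  have hD2 := hD (2 * (m + k) + 1) (by omega)
  have hb := bracket_ne_zero hθ (Nat.succ_ne_zero k)
  -- For `P_2 + u_1 P_0 = x P_1` the factor `D(0)` cannot be cancelled; the constant term of `P_2`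
  -- gives `u_1` directly.
  rcases Nat.eq_zero_or_pos (m + k) with h0 | hpos
  · obtain ⟨rfl, rfl⟩ : m = 0 ∧ k = 0 := by omega
    have hz : (P (2 * (0 + 0 + 1))).coeff (2 * (0 + 1)) = 1 := hone 2
    have hz' : (P (2 * (0 + 0))).coeff (2 * 0) = 1 := hone 0
    rw [hz] at e3
    rw [hz', uBracketOdd, if_pos rfl, mul_zero, coeff_X_mul_zero]
    simp only [mul_zero, zero_add, bracket_one_right, pow_one, one_mul, mul_one] at e3 hD1 ⊢
    field_simp
    apply mul_right_cancel₀ hθ.ne'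
    linear_combination e3
  · have hD3 := hD (2 * m + k) (by omega)
    have hD4 := hD (2 * (m + k)) (by omega)
    have e1 := h.coeff_odd_of_even hθ hρ hD hrec hone m k
    have e2 := h.coeff_even_of_odd hθ hρ hD hrec hone m k
    -- The recursion for the odd polynomial one place lower. At `m = 0` both sides vanish, the right
    -- one through `[0] = 0`.
    have e4 : bracket θ (k + 1) * bracketLin θ d₀ d₁ (2 * m + k) *
        (X * P (2 * (m + k) + 1)).coeff (2 * m) =
      -(θ ^ k * bracket θ m * bracketLin θ n₀ n₁ (m + 1) *
        (P (2 * (m + k) + 1)).coeff (2 * m + 1)) := by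
      rcases m with _ | m
      · rw [mul_zero, coeff_X_mul_zero, bracket_zero]; ring
      · have e := h.coeff_odd_rec hθ hρ hrec m (k + 1)
        rw [show 2 * (m + 1) = 2 * m + 1 + 1 by ring, coeff_X_mul]
        rw [show 2 * m + (k + 1) + 1 = 2 * m + 1 + 1 + k by ring,
          show m + (k + 1) = m + 1 + k by ring, show 2 * (m + 1) + 1 = 2 * m + 1 + 1 + 1 by ring]
          at e
        apply mul_right_cancel₀ hθ.ne'
        rw [e]
        ring
    rw [uBracketOdd, if_neg (by omega)]
    generalize (X * P (2 * (m + k) + 1)).coeff (2 * m) = y at *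
    generalize (P (2 * (m + k + 1))).coeff (2 * m) = x at *
    generalize (P (2 * (m + k))).coeff (2 * m) = b at *
    generalize (P (2 * (m + k) + 1)).coeff (2 * m + 1) = a at *
    generalize (P (2 * (m + k + 1))).coeff (2 * (m + 1)) = q at *
    -- All coefficients are now expressed through `b`, the one of `P_{2N}`; what remains is the
    -- identity `key` between brackets.
    have ex : x * (bracket θ (k + 1) * (bracketLin θ d₀ d₁ (2 * (m + k)) *
        bracketLin θ d₀ d₁ (2 * (m + k) + 1))) =
        -(θ ^ k * bracket θ (m + k + 1) * bracketLin θ d₀ d₁ (2 * m + k) *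
          bracketLin θ n₀ n₁ (m + k + 1) * b) := by
      apply mul_right_cancel₀ (mul_ne_zero hθ.ne' hD1)
      rw [show 2 * m + k + 1 = 2 * m + (k + 1) by ring] at e2
      linear_combination bracketLin θ d₀ d₁ (2 * (m + k)) *
          bracketLin θ d₀ d₁ (2 * (m + k) + 1) * e3 -
        θ ^ (k + 1) * bracketLin θ n₀ n₁ (m + 1) * bracketLin θ d₀ d₁ (2 * (m + k)) * e2 -
        θ ^ (k + 1) * bracket θ (m + k + 1) * bracketLin θ d₀ d₁ (2 * m + (k + 1)) * e1
    have ey : y * (bracket θ (k + 1) * bracketLin θ d₀ d₁ (2 * (m + k))) =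
        -(θ ^ k * bracket θ m * bracketLin θ n₀ n₁ (m + k + 1) * b) := by
      apply mul_right_cancel₀ hD3
      linear_combination bracketLin θ d₀ d₁ (2 * (m + k)) * e4 - θ ^ k * bracket θ m * e1
    have key : bracket θ (m + k + 1) * bracketLin θ d₀ d₁ (2 * m + k) -
        θ ^ m * bracketLin θ d₀ d₁ (m + k) * bracket θ (k + 1) =
        bracket θ m * bracketLin θ d₀ d₁ (2 * (m + k) + 1) := by
      simp only [bracketLin, two_mul, bracket_add, bracket_succ, pow_add]
      simp only [pow_eq_bracket θ]
      ring
    apply mul_right_cancel₀ (mul_ne_zero hb (mul_ne_zero hD4 hD2))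
    rw [add_mul, ex]
    field_simp
    rw [pow_add]
    linear_combination - bracketLin θ d₀ d₁ (2 * (m + k) + 1) * ey -
      θ ^ k * bracketLin θ n₀ n₁ (m + k + 1) * b * key

/-- The coefficients of odd powers in `P_{2N+3} + u_{2N+2} P_{2N+1} = x P_{2N+2}`. -/
theorem coeff_recurrence_even (h : IsBracketType lam nu θ d₀ d₁ n₀ n₁ ρ ε₀ ε₁) (hθ : 0 < θ)
    (hρ : ρ ≠ 0) (hD : ∀ k, k ≠ 0 → bracketLin θ d₀ d₁ k ≠ 0)
    (hN : ∀ k, k ≠ 0 → bracketLin θ n₀ n₁ k ≠ 0)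
    (hrec : ∀ n m, (lam n - lam m) * (P n).coeff m = nu (m + 2) * (P n).coeff (m + 2))
    (hone : ∀ n, (P n).coeff n = 1) (m k : ℕ) :
    (P (2 * (m + k + 1) + 1)).coeff (2 * m + 1) +
        uBracketEven θ d₀ d₁ n₀ n₁ (m + k + 1) * (P (2 * (m + k) + 1)).coeff (2 * m + 1) =
      (P (2 * (m + k + 1))).coeff (2 * m) := by
  have e3 := h.coeff_even_rec hθ hrec m (k + 1)
  have e1 := h.coeff_odd_of_even hθ hρ hD hrec hone m (k + 1)
  rw [show m + (k + 1) = m + k + 1 by ring] at e3 e1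
  have hD1 := hD (2 * m + (k + 1)) (by omega)
  have hD2 := hD (2 * (m + k) + 1) (by omega)
  have hD3 := hD (2 * (m + k + 1)) (by omega)
  have hN1 := hN (m + 1) (by omega)
  have hb := bracket_ne_zero hθ (Nat.succ_ne_zero k)
  have e2 := h.coeff_even_of_odd hθ hρ hD hrec hone m k
  rw [show 2 * m + k + 1 = 2 * m + (k + 1) by ring] at e2
  rw [uBracketEven, show 2 * (m + k + 1) - 1 = 2 * (m + k) + 1 by omega]
  generalize (P (2 * (m + k + 1))).coeff (2 * m) = x at *
  generalize (P (2 * (m + k) + 1)).coeff (2 * m + 1) = a at *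
  generalize (P (2 * (m + k + 1) + 1)).coeff (2 * m + 1) = r at *
  generalize (P (2 * (m + k + 1))).coeff (2 * (m + 1)) = q at *
  -- Here everything is expressed through `a`, the coefficient of the polynomial of lowest degree in
  -- the relation.
  have ex : x * (bracket θ (k + 1) * bracketLin θ d₀ d₁ (2 * (m + k) + 1)) =
      -(θ ^ k * bracket θ (m + k + 1) * bracketLin θ n₀ n₁ (m + 1) * a) := by
    apply mul_right_cancel₀ (mul_ne_zero hθ.ne' hD1)
    linear_combination bracketLin θ d₀ d₁ (2 * (m + k) + 1) * e3 -
      θ ^ (k + 1) * bracketLin θ n₀ n₁ (m + 1) * e2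
  have er : r * (bracket θ (k + 1) * (bracketLin θ d₀ d₁ (2 * (m + k) + 1) *
      bracketLin θ d₀ d₁ (2 * (m + k + 1)))) =
      -(θ ^ k * bracket θ (m + k + 1) * bracketLin θ n₀ n₁ (m + k + 1 + 1) *
        bracketLin θ d₀ d₁ (2 * m + (k + 1)) * a) := by
    apply mul_right_cancel₀ hN1
    linear_combination (bracket θ (k + 1) * bracketLin θ d₀ d₁ (2 * (m + k) + 1)) * e1 +
      bracketLin θ d₀ d₁ (2 * m + (k + 1)) * bracketLin θ n₀ n₁ (m + k + 1 + 1) * ex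
  have key : -(θ ^ k * bracketLin θ d₀ d₁ (2 * m + (k + 1)) * bracketLin θ n₀ n₁ (m + k + 1 + 1)) +
      bracket θ (k + 1) * (bracketLin θ n₀ n₁ (m + k + 1 + 1) *
        bracketLin θ d₀ d₁ (2 * (m + k) + 1) -
        bracketLin θ n₀ n₁ (m + k + 1) * bracketLin θ d₀ d₁ (2 * (m + k + 1))) =
      -(θ ^ k * bracketLin θ n₀ n₁ (m + 1) * bracketLin θ d₀ d₁ (2 * (m + k + 1))) := by
    simp only [bracketLin, two_mul, bracket_add, pow_add, bracket_one_right, pow_one]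
    simp only [pow_eq_bracket θ m, pow_eq_bracket θ k]
    ring
  apply mul_right_cancel₀ (mul_ne_zero hb (mul_ne_zero hD2 hD3))
  rw [add_mul, er]
  field_simp
  linear_combination (bracket θ (m + k + 1) * a) * key -
    bracketLin θ d₀ d₁ (2 * (m + k + 1)) * ex

theorem hasSymmetricRecurrence (h : IsBracketType lam nu θ d₀ d₁ n₀ n₁ ρ ε₀ ε₁) (hθ : 0 < θ)
    (hL : ActsOnMonomials L lam nu) (hlam : ∀ n m : ℕ, n ≠ m → lam n ≠ lam m)
    (hnu0 : nu 0 = 0) (hnu1 : nu 1 = 0) (hnu : ∀ n : ℕ, 2 ≤ n → nu n ≠ 0)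
    (hP : IsMonicEigenfamily L lam P) :
    HasSymmetricRecurrence P (uBracketEven θ d₀ d₁ n₀ n₁) (uBracketOdd θ d₀ d₁ n₀ n₁) := by
  have hρ := h.rho_ne_zero hnu
  have hD : ∀ k, k ≠ 0 → bracketLin θ d₀ d₁ k ≠ 0 := fun k hk => h.den_ne_zero hlam hk
  have hN : ∀ k, k ≠ 0 → bracketLin θ n₀ n₁ k ≠ 0 := fun k hk => h.num_ne_zero hnu hk
  have hrec := hP.coeff_rec hL hnu0 hnu1
  have hone := hP.coeff_self
  have hodd : ∀ {n m : ℕ}, (n + m) % 2 = 1 → (P n).coeff m = 0 :=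
    fun hnm => hP.coeff_eq_zero_of_odd_add hL hlam hnu0 hnu1 hnm
  constructor
  · intro n hn
    obtain ⟨n, rfl⟩ : ∃ l, n = l + 1 := ⟨n - 1, by omega⟩
    ext i
    rw [coeff_add, coeff_C_mul, show 2 * (n + 1) - 1 = 2 * n + 1 by omega]
    rcases Nat.even_or_odd' i with ⟨m, rfl | rfl⟩
    · rw [hodd (by omega), hodd (by omega)]
      rcases m with _ | m
      · simp
      · rw [show 2 * (m + 1) = 2 * m + 1 + 1 by ring, coeff_X_mul, hodd (by omega)]; simp
    · rw [coeff_X_mul]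
      rcases lt_trichotomy m (n + 1) with hlt | rfl | hgt
      · obtain ⟨k, rfl⟩ : ∃ k, n = m + k := ⟨n - m, by omega⟩
        exact h.coeff_recurrence_even hθ hρ hD hN hrec hone m k
      · rw [hone, hone, hP.coeff_of_lt (by omega)]; simp
      · rw [hP.coeff_of_lt (by omega), hP.coeff_of_lt (by omega), hP.coeff_of_lt (by omega)]; simp
  · intro n
    ext i
    rw [coeff_add, coeff_C_mul, show 2 * n + 2 = 2 * (n + 1) by ring]
    rcases Nat.even_or_odd' i with ⟨m, rfl | rfl⟩
    · rcases lt_trichotomy m (n + 1) with hlt | rfl | hgt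
      · obtain ⟨k, rfl⟩ : ∃ k, n = m + k := ⟨n - m, by omega⟩
        exact h.coeff_recurrence_odd hθ hρ hD hrec hone m k
      · rw [hone, hP.coeff_of_lt (by omega), show 2 * (n + 1) = 2 * n + 1 + 1 by ring, coeff_X_mul,
          hone]
        simp
      · obtain ⟨m, rfl⟩ : ∃ l, m = l + 1 := ⟨m - 1, by omega⟩
        rw [hP.coeff_of_lt (by omega), hP.coeff_of_lt (by omega),
          show 2 * (m + 1) = 2 * m + 1 + 1 by ring, coeff_X_mul, hP.coeff_of_lt (by omega)]
        simp
    · rw [coeff_X_mul, hodd (by omega), hodd (by omega), hodd (by omega)]; simp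

end IsBracketType

end BracketType

/-! ### The four families as bracket types and their explicit recurrence coefficients -/

section Families

variable {lam nu : ℕ → ℝ} {q a b s κ ρ ε₀ ε₁ : ℝ}

theorem bracketLin_add_neg (θ A B : ℝ) (k : ℕ) :
    bracketLin θ (A + B) (-(B * (1 - θ))) k = A + B * θ ^ k := by
  rw [bracketLin, pow_eq_bracket θ k]; ring

theorem bracket_eq_div {θ : ℝ} (hθ : θ ≠ 1) (n : ℕ) : bracket θ n = (1 - θ ^ n) / (1 - θ) := by
  have : 1 - θ ≠ 0 := sub_ne_zero.2 hθ.symm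
  rw [eq_div_iff this, mul_comm, one_sub_mul_bracket]

theorem HasSymmetricRecurrence.congr {P : ℕ → ℝ[X]} {ue uo ve vo : ℕ → ℝ}
    (h : HasSymmetricRecurrence P ue uo) (he : ∀ n, ue (n + 1) = ve (n + 1))
    (ho : ∀ n, uo n = vo n) : HasSymmetricRecurrence P ve vo := by
  obtain rfl : uo = vo := funext ho
  refine ⟨fun n hn => ?_, h.2⟩
  obtain ⟨n, rfl⟩ : ∃ l, n = l + 1 := ⟨n - 1, by omega⟩
  rw [← he]
  exact h.1 _ hn

theorem IsLittleQJacobiType.isBracketType (h : IsLittleQJacobiType lam nu q a b s κ ρ ε₀ ε₁)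
    (hq : 0 < q) (hq1 : q < 1) :
    IsBracketType lam nu (q ^ 2) (κ * (1 - q ^ 2) + κ * (1 - q ^ 2) * a)
      (-(κ * (1 - q ^ 2) * a * (1 - q ^ 2)))
      (κ * s * (1 - q ^ 2) + κ * s * (1 - q ^ 2) * b)
      (-(κ * s * (1 - q ^ 2) * b * (1 - q ^ 2))) ρ ε₀ ε₁ := by
  intro n
  obtain ⟨h1, h2, h3, h4⟩ := h n
  have hQ : q ^ 2 < 1 := pow_lt_one₀ hq.le hq1 two_ne_zero
  have hQ' : 1 - q ^ 2 ≠ 0 := by linarith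
  have hp : (q ^ 2) ^ n ≠ 0 := by positivity
  rw [h1, h2, h3, h4]
  simp only [bracketLin_add_neg, bracket_eq_div hQ.ne, pow_mul, pow_succ (q ^ 2) n]
  refine ⟨?_, ?_, ?_, ?_⟩ <;> field_simp <;> ring

/-- Here `D(k)` is a pure multiple of `θ^k`. In the odd eigenvalues `D(n+1)` leaves an extra factor
`θ = q^2` and the sign is opposite, hence `-ρ / q ^ 2`. -/
theorem IsQLaguerreType.isBracketType (h : IsQLaguerreType lam nu q b s κ ρ ε₀ ε₁)
    (hq : 0 < q) (hq1 : q < 1) :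
    IsBracketType lam nu (q ^ 2) (0 + κ * (1 - q ^ 2)) (-(κ * (1 - q ^ 2) * (1 - q ^ 2)))
      (κ * s * (1 - q ^ 2) + κ * s * (1 - q ^ 2) * b)
      (-(κ * s * (1 - q ^ 2) * b * (1 - q ^ 2))) (-ρ / q ^ 2) ε₀ ε₁ := by
  intro n
  obtain ⟨h1, h2, h3, h4⟩ := h n
  have hQ : q ^ 2 < 1 := pow_lt_one₀ hq.le hq1 two_ne_zero
  have hQ' : 1 - q ^ 2 ≠ 0 := by linarith
  have hp : (q ^ 2) ^ n ≠ 0 := by positivity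
  have e : q ^ (2 * n + 2) = (q ^ 2) ^ n * q ^ 2 := by rw [pow_add, pow_mul]
  rw [h1, h2, h3, h4, e]
  simp only [bracketLin_add_neg, bracket_eq_div hQ.ne, pow_mul, pow_succ (q ^ 2) n]
  refine ⟨?_, ?_, ?_, ?_⟩ <;> field_simp <;> ring

theorem IsJacobiType.isBracketType (h : IsJacobiType lam nu a b s κ ρ ε₀ ε₁) :
    IsBracketType lam nu 1 (-(2 * κ * a)) (-(4 * κ)) (-(2 * κ * s * b)) (-(4 * κ * s)) ρ ε₀ ε₁ := by
  intro n
  obtain ⟨h1, h2, h3, h4⟩ := h n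
  rw [h1, h2, h3, h4]
  simp only [bracketLin, bracket_one_left, one_pow, inv_one]
  push_cast
  refine ⟨?_, ?_, ?_, ?_⟩ <;> ring

theorem IsLaguerreType.isBracketType (h : IsLaguerreType lam nu b s κ ρ ε₀ ε₁) :
    IsBracketType lam nu 1 (-(2 * κ)) 0 (-(2 * κ * s * b)) (-(4 * κ * s)) ρ ε₀ ε₁ := by
  intro n
  obtain ⟨h1, h2, h3, h4⟩ := h n
  rw [h1, h2, h3, h4]
  simp only [bracketLin, bracket_one_left, one_pow, inv_one]
  push_cast
  refine ⟨?_, ?_, ?_, ?_⟩ <;> ring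

variable {L : ℝ[X] →ₗ[ℝ] ℝ[X]} {P : ℕ → ℝ[X]}

theorem IsLittleQJacobiType.hasSymmetricRecurrence
    (h : IsLittleQJacobiType lam nu q a b s κ ρ ε₀ ε₁) (hq : 0 < q) (hq1 : q < 1)
    (hL : ActsOnMonomials L lam nu) (hlam : ∀ n m : ℕ, n ≠ m → lam n ≠ lam m)
    (hnu0 : nu 0 = 0) (hnu1 : nu 1 = 0) (hnu : ∀ n : ℕ, 2 ≤ n → nu n ≠ 0)
    (hP : IsMonicEigenfamily L lam P) :
    HasSymmetricRecurrence P
      (fun n => s * uQJacobiEven q a b n) (fun n => s * uQJacobiOdd q a b n) := by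
  have hB := h.isBracketType hq hq1
  have hQ : q ^ 2 < 1 := pow_lt_one₀ hq.le hq1 two_ne_zero
  have hD : ∀ k, k ≠ 0 → κ * (1 - q ^ 2) + κ * (1 - q ^ 2) * a * (q ^ 2) ^ k ≠ 0 := fun k hk => by
    rw [← bracketLin_add_neg]; exact hB.den_ne_zero hlam hk
  have hκ : κ ≠ 0 := fun h0 => hD 1 one_ne_zero (by rw [h0]; ring)
  have hQ' : 1 - q ^ 2 ≠ 0 := by linarith
  have hD' : ∀ k, k ≠ 0 → 1 + a * (q ^ 2) ^ k ≠ 0 := fun k hk h0 =>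
    hD k hk (by linear_combination κ * (1 - q ^ 2) * h0)
  refine (hB.hasSymmetricRecurrence (by positivity) hL hlam hnu0 hnu1 hnu hP).congr
    (fun n => ?_) fun n => ?_
  · have hD1 := hD' (2 * n + 1) (by omega)
    have hD2 := hD' (2 * n + 2) (by omega)
    simp only [uBracketEven, uQJacobiEven, bracketLin_add_neg, bracket_eq_div hQ.ne]
    rw [show 4 * (n + 1) - 2 = 2 * (2 * n + 1) by omega, show 4 * (n + 1) = 2 * (2 * n + 2) by ring,
      show 2 * (n + 1) - 2 = 2 * n by omega, show 2 * (n + 1) - 1 = 2 * n + 1 by omega,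
      show 2 * (n + 1) = 2 * n + 2 by ring, show 2 * n + 2 = 2 * (n + 1) by ring]
    simp only [pow_mul q 2]
    rw [show 2 * (n + 1) = 2 * n + 2 by ring]
    field_simp
    generalize q ^ 2 = Q
    ring
  · rcases Nat.eq_zero_or_pos n with rfl | hn
    · have hD1 := hD' 1 (by omega)
      rw [pow_one] at hD1
      simp only [uBracketOdd, uQJacobiOdd, bracketLin_add_neg, if_true, pow_one]
      field_simp
      ring
    · have hD1 := hD' (2 * n + 1) (by omega)
      have hD2 := hD' (2 * n) (by omega)
      simp only [uBracketOdd, uQJacobiOdd, bracketLin_add_neg, if_neg hn.ne']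
      rw [show 4 * n + 2 = 2 * (2 * n + 1) by ring, show 4 * n = 2 * (2 * n) by ring,
        show 2 * n + 2 = 2 * (n + 1) by ring]
      simp only [pow_mul q 2]
      field_simp
      ring

theorem IsQLaguerreType.hasSymmetricRecurrence
    (h : IsQLaguerreType lam nu q b s κ ρ ε₀ ε₁) (hq : 0 < q) (hq1 : q < 1)
    (hL : ActsOnMonomials L lam nu) (hlam : ∀ n m : ℕ, n ≠ m → lam n ≠ lam m)
    (hnu0 : nu 0 = 0) (hnu1 : nu 1 = 0) (hnu : ∀ n : ℕ, 2 ≤ n → nu n ≠ 0)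
    (hP : IsMonicEigenfamily L lam P) :
    HasSymmetricRecurrence P
      (fun n => s * uQLaguerreEven q n) (fun n => s * uQLaguerreOdd q b n) := by
  have hB := h.isBracketType hq hq1
  have hQ : q ^ 2 < 1 := pow_lt_one₀ hq.le hq1 two_ne_zero
  have hQ' : 1 - q ^ 2 ≠ 0 := by linarith
  have hκ : κ ≠ 0 := by
    rintro rfl
    refine hB.den_ne_zero hlam one_ne_zero ?_
    rw [bracketLin_add_neg]; ring
  refine (hB.hasSymmetricRecurrence (by positivity) hL hlam hnu0 hnu1 hnu hP).congr
    (fun n => ?_) fun n => ?_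
  · simp only [uBracketEven, uQLaguerreEven, bracketLin_add_neg, bracket_eq_div hQ.ne]
    rw [show 4 * (n + 1) = 2 * (2 * n + 2) by ring, show 2 * (n + 1) - 1 = 2 * n + 1 by omega]
    simp only [pow_mul q 2]
    rw [show 2 * (n + 1) = 2 * n + 2 by ring]
    field_simp
    generalize q ^ 2 = Q
    ring
  · rcases Nat.eq_zero_or_pos n with rfl | hn
    · simp only [uBracketOdd, uQLaguerreOdd, bracketLin_add_neg, if_true, pow_one]
      field_simp
      ring
    · simp only [uBracketOdd, uQLaguerreOdd, bracketLin_add_neg, if_neg hn.ne']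
      rw [show 4 * n + 2 = 2 * (2 * n + 1) by ring, show 2 * n + 2 = 2 * (n + 1) by ring]
      simp only [pow_mul q 2]
      field_simp
      generalize q ^ 2 = Q
      ring

theorem IsJacobiType.hasSymmetricRecurrence
    (h : IsJacobiType lam nu a b s κ ρ ε₀ ε₁)
    (hL : ActsOnMonomials L lam nu) (hlam : ∀ n m : ℕ, n ≠ m → lam n ≠ lam m)
    (hnu0 : nu 0 = 0) (hnu1 : nu 1 = 0) (hnu : ∀ n : ℕ, 2 ≤ n → nu n ≠ 0)
    (hP : IsMonicEigenfamily L lam P) :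
    HasSymmetricRecurrence P
      (fun n => s * uJacobiEven a b n) (fun n => s * uJacobiOdd a b n) := by
  have hB := h.isBracketType
  have hκ : κ ≠ 0 := by
    rintro rfl
    exact hB.den_ne_zero hlam one_ne_zero (by simp [bracketLin])
  have hD : ∀ k : ℕ, k ≠ 0 → a + 2 * k ≠ 0 := fun k hk h0 => by
    refine hB.den_ne_zero hlam hk ?_
    rw [bracketLin, bracket_one_left]
    linear_combination -2 * κ * h0
  have hlin : ∀ x : ℝ, -(2 * κ * a) + -(4 * κ) * x = -2 * κ * (a + 2 * x) := fun x => by ring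
  have hlin' : ∀ x : ℝ, -(2 * κ * s * b) + -(4 * κ * s) * x = -2 * κ * s * (b + 2 * x) :=
    fun x => by ring
  refine (hB.hasSymmetricRecurrence one_pos hL hlam hnu0 hnu1 hnu hP).congr
    (fun n => ?_) fun n => ?_
  · have hD1 := hD (2 * n + 1) (by omega)
    have hD2 := hD (2 * n + 2) (by omega)
    simp only [uBracketEven, uJacobiEven, bracketLin, bracket_one_left, hlin, hlin']
    rw [show 2 * (n + 1) - 1 = 2 * n + 1 by omega]
    push_cast at hD1 hD2 ⊢
    rw [show a + 4 * ((n : ℝ) + 1) - 2 = a + 2 * (2 * n + 1) by ring,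
      show a + 4 * ((n : ℝ) + 1) = a + 2 * (2 * n + 2) by ring,
      show 2 * ((n : ℝ) + 1) = 2 * n + 2 by ring]
    -- With `x = a + 4n + 2` as variable the two denominators are `x` and `x + 2`.
    obtain ⟨x, hx⟩ : ∃ x, x = a + 2 * (2 * (n : ℝ) + 1) := ⟨_, rfl⟩
    rw [← hx] at hD1 ⊢
    obtain rfl : a = x - 2 * (2 * n + 1) := by rw [hx]; ring
    rw [show x - 2 * (2 * (n : ℝ) + 1) + 2 * (2 * n + 2) = x + 2 by ring] at hD2 ⊢
    field_simp
    ring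
  · rcases Nat.eq_zero_or_pos n with rfl | hn
    · have hD1 := hD 1 (by omega)
      simp only [uBracketOdd, uJacobiOdd, bracketLin, bracket_one_left, hlin, hlin', if_true]
      push_cast at hD1 ⊢
      rw [mul_one] at hD1 ⊢
      field_simp
      ring
    · have hD1 := hD (2 * n + 1) (by omega)
      have hD2 := hD (2 * n) (by omega)
      simp only [uBracketOdd, uJacobiOdd, bracketLin, bracket_one_left, hlin, hlin',
        if_neg hn.ne', one_pow]
      push_cast at hD1 hD2 ⊢
      rw [show a + 4 * (n : ℝ) + 2 = a + 2 * (2 * n + 1) by ring,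
        show a + 4 * (n : ℝ) = a + 2 * (2 * n) by ring]
      field_simp
      ring

theorem IsLaguerreType.hasSymmetricRecurrence
    (h : IsLaguerreType lam nu b s κ ρ ε₀ ε₁)
    (hL : ActsOnMonomials L lam nu) (hlam : ∀ n m : ℕ, n ≠ m → lam n ≠ lam m)
    (hnu0 : nu 0 = 0) (hnu1 : nu 1 = 0) (hnu : ∀ n : ℕ, 2 ≤ n → nu n ≠ 0)
    (hP : IsMonicEigenfamily L lam P) :
    HasSymmetricRecurrence P
      (fun n => s * uLaguerreEven n) (fun n => s * uLaguerreOdd b n) := by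
  have hB := h.isBracketType
  have hκ : κ ≠ 0 := by
    rintro rfl
    exact hB.den_ne_zero hlam one_ne_zero (by simp [bracketLin])
  refine (hB.hasSymmetricRecurrence one_pos hL hlam hnu0 hnu1 hnu hP).congr
    (fun n => ?_) fun n => ?_
  · simp only [uBracketEven, uLaguerreEven, bracketLin, bracket_one_left, zero_mul, add_zero]
    push_cast
    field_simp
    ring
  · rcases Nat.eq_zero_or_pos n with rfl | hn
    · simp only [uBracketOdd, uLaguerreOdd, bracketLin, bracket_one_left, zero_mul, add_zero,
        if_true]
      push_cast
      field_simp
      ring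
    · simp only [uBracketOdd, uLaguerreOdd, bracketLin, bracket_one_left, zero_mul, add_zero,
        if_neg hn.ne', one_pow]
      push_cast
      field_simp
      ring

end Families

/-! ### Favard's theorem for symmetric recurrences -/

section Favard

variable {L : ℝ[X] →ₗ[ℝ] ℝ[X]} {lam : ℕ → ℝ} {P : ℕ → ℝ[X]} {u ue uo : ℕ → ℝ}
  {σ : ℝ[X] →ₗ[ℝ] ℝ}

/-- A monic eigenfamily as a polynomial sequence. -/
noncomputable def IsMonicEigenfamily.toSequence (hP : IsMonicEigenfamily L lam P) :
    Polynomial.Sequence ℝ where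
  elems' := P
  degree_eq' n := by rw [degree_eq_natDegree (hP n).1.ne_zero, (hP n).2.1]

/-- A monic eigenfamily as a basis of the polynomials. -/
noncomputable def IsMonicEigenfamily.basis (hP : IsMonicEigenfamily L lam P) :
    Module.Basis ℕ ℝ ℝ[X] :=
  hP.toSequence.basis fun n => by
    have : hP.toSequence n = P n := rfl
    rw [this, (hP n).1.leadingCoeff]
    exact isUnit_one

theorem IsMonicEigenfamily.basis_apply (hP : IsMonicEigenfamily L lam P) (n : ℕ) :
    hP.basis n = P n := by
  simp [IsMonicEigenfamily.basis]
  rfl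

theorem IsMonicEigenfamily.zero_eq (hP : IsMonicEigenfamily L lam P) : P 0 = 1 :=
  (hP 0).1.natDegree_eq_zero.1 (hP 0).2.1

theorem IsMonicEigenfamily.one_eq {nu : ℕ → ℝ} (hP : IsMonicEigenfamily L lam P)
    (hL : ActsOnMonomials L lam nu) (hlam : ∀ n m : ℕ, n ≠ m → lam n ≠ lam m)
    (hnu0 : nu 0 = 0) (hnu1 : nu 1 = 0) : P 1 = X := by
  have h := eq_X_add_C_of_natDegree_le_one (hP 1).2.1.le
  rwa [hP.coeff_self 1, hP.coeff_eq_zero_of_odd_add hL hlam hnu0 hnu1 (by norm_num), map_one,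
    one_mul, map_zero, add_zero] at h

theorem map_C_mul (σ : ℝ[X] →ₗ[ℝ] ℝ) (c : ℝ) (p : ℝ[X]) : σ (C c * p) = c * σ p := by
  rw [← smul_eq_C_mul, map_smul, smul_eq_mul]

/-- A three-term recurrence with vanishing diagonal coefficients. -/
def IsThreeTerm (P : ℕ → ℝ[X]) (u : ℕ → ℝ) : Prop :=
  P 0 = 1 ∧ P 1 = X ∧ ∀ n, X * P (n + 1) = P (n + 2) + C (u n) * P n

/-- The index is that of the lower polynomial: `u n` here is `u_{n+1}` of the recurrence, so even
`n` takes its value from `uo`. -/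
theorem HasSymmetricRecurrence.isThreeTerm (h : HasSymmetricRecurrence P ue uo)
    (h0 : P 0 = 1) (h1 : P 1 = X) :
    IsThreeTerm P (fun n => if n % 2 = 0 then uo (n / 2) else ue (n / 2 + 1)) := by
  refine ⟨h0, h1, fun n => ?_⟩
  rcases Nat.even_or_odd' n with ⟨m, rfl | rfl⟩
  · have := h.2 m
    simp only [Nat.mul_mod_right, if_true, Nat.mul_div_cancel_left m two_pos]
    exact this.symm
  · have := h.1 (m + 1) (by omega)
    dsimp only
    rw [if_neg (by omega), show (2 * m + 1) / 2 = m by omega]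
    rw [show 2 * (m + 1) - 1 = 2 * m + 1 by omega] at this
    exact this.symm

theorem IsThreeTerm.map_succ_mul (h : IsThreeTerm P u) (σ : ℝ[X] →ₗ[ℝ] ℝ) (p : ℝ[X]) (n : ℕ) :
    σ (P (n + 1) * (X * p)) = σ (P (n + 2) * p) + u n * σ (P n * p) := by
  rw [show P (n + 1) * (X * p) = X * P (n + 1) * p by ring, h.2.2 n, add_mul, map_add, mul_assoc,
    map_C_mul]

/-- Up to lower terms `P_{n+1}` is `x P_n`; moving `x` to the other factor leaves only the term in
`P_n`. -/
theorem IsThreeTerm.norm_succ (h : IsThreeTerm P u) (hσ : IsOrthogonalFor σ P) (n : ℕ) :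
    σ (P (n + 1) * P (n + 1)) = u n * σ (P n * P n) := by
  have key : σ (P (n + 1) * P (n + 1)) = σ (P (n + 1) * (X * P n)) := by
    rcases n with _ | n
    · rw [h.1, mul_one, zero_add, h.2.1]
    · rw [h.2.2 n, mul_add, map_add, show P (n + 1 + 1) * (C (u n) * P n) =
        C (u n) * (P (n + 1 + 1) * P n) by ring, map_C_mul, hσ (n + 1 + 1) n (by omega), mul_zero,
        add_zero]
  rw [key, h.map_succ_mul, hσ (n + 2) n (by omega), zero_add]

theorem IsThreeTerm.pos_of_isPositiveDefiniteFunctional (h : IsThreeTerm P u)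
    (hσ : IsOrthogonalFor σ P) (hpos : IsPositiveDefiniteFunctional σ) (hne : ∀ n, P n ≠ 0) (n : ℕ) :
    0 < u n := by
  have h1 := hpos _ (hne (n + 1))
  rw [h.norm_succ hσ] at h1
  exact pos_of_mul_pos_left h1 (hpos _ (hne n)).le

/-- Induction on the smaller degree: the recurrence lowers it, and the freed `x` is absorbed by the
larger factor, whose degree stays above. -/
theorem IsThreeTerm.map_mul_eq_zero (h : IsThreeTerm P u) (hσ : ∀ n, σ (P (n + 1)) = 0)
    (m : ℕ) : ∀ n, σ (P (n + m + 1) * P m) = 0 := by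
  induction m using Nat.strong_induction_on with
  | _ m ih =>
    intro n
    rcases m with _ | _ | m
    · rw [h.1, mul_one]; exact hσ n
    · rw [h.2.1, ← mul_one X, h.map_succ_mul, mul_one, mul_one, hσ, hσ]; ring
    · have e : P (m + 2) = X * P (m + 1) - C (u m) * P m := by rw [h.2.2]; ring
      have e1 := ih (m + 1) (by omega) (n + 2)
      have e2 := ih (m + 1) (by omega) n
      have e3 := ih m (by omega) (n + 2)
      rw [show n + (m + 1 + 1) + 1 = n + m + 2 + 1 by ring, show m + 1 + 1 = m + 2 by ring, e,
        mul_sub, map_sub, h.map_succ_mul, show P (n + m + 2 + 1) * (C (u m) * P m) =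
        C (u m) * (P (n + m + 2 + 1) * P m) by ring, map_C_mul]
      rw [show n + 2 + (m + 1) + 1 = n + m + 2 + 2 by ring] at e1
      rw [show n + (m + 1) + 1 = n + m + 2 by ring] at e2
      rw [show n + 2 + m + 1 = n + m + 2 + 1 by ring] at e3
      rw [e1, e2, e3]; ring

theorem IsThreeTerm.isOrthogonalFor (h : IsThreeTerm P u) (hσ : ∀ n, σ (P (n + 1)) = 0) :
    IsOrthogonalFor σ P := by
  intro n m hnm
  rcases lt_or_gt_of_ne hnm with hlt | hlt
  · obtain ⟨k, rfl⟩ : ∃ k, m = k + n + 1 := ⟨m - n - 1, by omega⟩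
    rw [mul_comm]; exact h.map_mul_eq_zero hσ n k
  · obtain ⟨k, rfl⟩ : ∃ k, n = k + m + 1 := ⟨n - m - 1, by omega⟩
    exact h.map_mul_eq_zero hσ m k

theorem isPositiveDefiniteFunctional_of_basis (B : Module.Basis ℕ ℝ ℝ[X])
    (horth : ∀ n m, n ≠ m → σ (B n * B m) = 0) (hpos : ∀ n, 0 < σ (B n * B n)) :
    IsPositiveDefiniteFunctional σ := by
  intro p hp
  have hrepr : p = ∑ i ∈ (B.repr p).support, B.repr p i • B i := by
    conv_lhs => rw [← B.linearCombination_repr p, Finsupp.linearCombination_apply, Finsupp.sum]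
  have e : σ (p * p) = ∑ i ∈ (B.repr p).support, B.repr p i ^ 2 * σ (B i * B i) := by
    conv_lhs => rw [hrepr]
    rw [Finset.sum_mul_sum, map_sum]
    refine Finset.sum_congr rfl fun i hi => ?_
    rw [map_sum, Finset.sum_eq_single i]
    · rw [smul_mul_smul_comm, map_smul, smul_eq_mul, sq]
    · intro j _ hj
      rw [smul_mul_smul_comm, map_smul, horth i j hj.symm, smul_zero]
    · exact fun h => absurd hi h
  rw [e]
  refine Finset.sum_pos (fun i hi => ?_) ?_
  · exact mul_pos (sq_pos_iff.2 (Finsupp.mem_support_iff.1 hi)) (hpos i)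
  · rw [Finsupp.support_nonempty_iff]
    exact fun h => hp (B.repr.map_eq_zero_iff.1 h)

/-- The functional is the coordinate along `P_0`. It makes the `P_n` orthogonal, and their square
norms are products of the `u_i`. -/
theorem IsMonicEigenfamily.isPositiveDefiniteOPS (hP : IsMonicEigenfamily L lam P)
    (h : IsThreeTerm P u) (hu : ∀ n, 0 < u n) : IsPositiveDefiniteOPS P := by
  let σ : ℝ[X] →ₗ[ℝ] ℝ := hP.basis.constr ℝ fun n => if n = 0 then (1 : ℝ) else 0
  have hσ : ∀ n, σ (P n) = if n = 0 then 1 else 0 := fun n => by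
    rw [← hP.basis_apply n]; exact hP.basis.constr_basis ℝ _ n
  have horth : IsOrthogonalFor σ P := h.isOrthogonalFor fun n => by rw [hσ, if_neg (by omega)]
  have hpos : ∀ n, 0 < σ (P n * P n) := fun n => by
    induction n with
    | zero => rw [h.1, mul_one, ← h.1, hσ, if_pos rfl]; exact one_pos
    | succ n ih => rw [h.norm_succ horth]; exact mul_pos (hu n) ih
  exact ⟨σ, isPositiveDefiniteFunctional_of_basis hP.basis
    (fun n m hnm => by rw [hP.basis_apply, hP.basis_apply]; exact horth n m hnm)
    (fun n => by rw [hP.basis_apply]; exact hpos n), horth⟩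

theorem IsMonicEigenfamily.isPositiveDefiniteOPS_of_hasSymmetricRecurrence {nu : ℕ → ℝ}
    (hP : IsMonicEigenfamily L lam P)
    (hL : ActsOnMonomials L lam nu) (hlam : ∀ n m : ℕ, n ≠ m → lam n ≠ lam m)
    (hnu0 : nu 0 = 0) (hnu1 : nu 1 = 0) (h : HasSymmetricRecurrence P ue uo)
    (he : ∀ n, 0 < ue (n + 1)) (ho : ∀ n, 0 < uo n) : IsPositiveDefiniteOPS P := by
  refine hP.isPositiveDefiniteOPS
    (h.isThreeTerm hP.zero_eq (hP.one_eq hL hlam hnu0 hnu1)) fun n => ?_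
  split_ifs
  · exact ho _
  · exact he _

theorem IsMonicEigenfamily.even_pos_of_hasSymmetricRecurrence {nu : ℕ → ℝ}
    (hP : IsMonicEigenfamily L lam P)
    (hL : ActsOnMonomials L lam nu) (hlam : ∀ n m : ℕ, n ≠ m → lam n ≠ lam m)
    (hnu0 : nu 0 = 0) (hnu1 : nu 1 = 0) (h : HasSymmetricRecurrence P ue uo)
    (hσ : IsOrthogonalFor σ P) (hpos : IsPositiveDefiniteFunctional σ) (n : ℕ) :
    0 < ue (n + 1) := by
  have := (h.isThreeTerm hP.zero_eq
    (hP.one_eq hL hlam hnu0 hnu1)).pos_of_isPositiveDefiniteFunctional hσ hpos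
    (fun k => (hP k).1.ne_zero) (2 * n + 1)
  rwa [if_neg (by omega), show (2 * n + 1) / 2 = n by omega] at this

end Favard

/-! ### Positivity of the recurrence coefficients in the stated parameter ranges -/

section Sufficiency

variable {L : ℝ[X] →ₗ[ℝ] ℝ[X]} {lam nu : ℕ → ℝ} {P : ℕ → ℝ[X]} {q a b s κ ρ ε₀ ε₁ : ℝ}

theorem IsLittleQJacobiType.isPositiveDefiniteOPS
    (h : IsLittleQJacobiType lam nu q a b s κ ρ ε₀ ε₁) (hq : 0 < q) (hq1 : q < 1) (hs : 0 < s)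
    (hb : -(q ^ 2)⁻¹ < b) (hb0 : b ≤ 0) (hab : b < a)
    (hL : ActsOnMonomials L lam nu) (hlam : ∀ n m : ℕ, n ≠ m → lam n ≠ lam m)
    (hnu0 : nu 0 = 0) (hnu1 : nu 1 = 0) (hnu : ∀ n : ℕ, 2 ≤ n → nu n ≠ 0)
    (hP : IsMonicEigenfamily L lam P) : IsPositiveDefiniteOPS P := by
  -- As `b ≤ 0`, the worst case is `x = b`, `k = 2`, which is the hypothesis `hb`.
  have hbound : ∀ x, b ≤ x → ∀ k, 2 ≤ k → 0 < 1 + x * q ^ k := fun x hx k hk => by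
    have hk1 : q ^ k ≤ q ^ 2 := pow_le_pow_of_le_one hq.le hq1.le hk
    have hk0 : 0 < q ^ k := by positivity
    have h1 : -1 < b * q ^ 2 := by
      have := mul_lt_mul_of_pos_right hb (show 0 < q ^ 2 by positivity)
      rwa [neg_mul, inv_mul_cancel₀ (by positivity)] at this
    nlinarith [mul_le_mul_of_nonneg_right hx hk0.le, mul_le_mul_of_nonpos_left hk1 hb0]
  refine hP.isPositiveDefiniteOPS_of_hasSymmetricRecurrence hL hlam hnu0 hnu1
    (h.hasSymmetricRecurrence hq hq1 hL hlam hnu0 hnu1 hnu hP) (fun n => ?_) fun n => ?_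
  · refine mul_pos hs (div_pos (mul_pos (mul_pos (by positivity) ?_) ?_) (mul_pos ?_ ?_))
    · exact sub_pos.2 (pow_lt_one₀ hq.le hq1 (by omega))
    · have h1 : q ^ (2 * (n + 1) - 2) ≤ 1 := pow_le_one₀ hq.le hq1.le
      have h0 : 0 < q ^ (2 * (n + 1) - 2) := by positivity
      nlinarith [mul_lt_mul_of_pos_right hab h0, mul_le_mul_of_nonpos_left h1 hb0]
    · exact hbound a hab.le _ (by omega)
    · exact hbound a hab.le _ (by omega)
  · refine mul_pos hs ?_
    rw [uQJacobiOdd]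
    split_ifs with hn
    · exact div_pos (by linarith [hbound b le_rfl 2 le_rfl]) (hbound a hab.le 2 le_rfl)
    · refine div_pos (mul_pos (mul_pos (by positivity) ?_) ?_) (mul_pos ?_ ?_)
      · linarith [hbound b le_rfl (2 * n + 2) (by omega)]
      · linarith [hbound a hab.le (2 * n) (by omega)]
      · exact hbound a hab.le _ (by omega)
      · exact hbound a hab.le _ (by omega)

theorem IsQLaguerreType.isPositiveDefiniteOPS
    (h : IsQLaguerreType lam nu q b s κ ρ ε₀ ε₁) (hq : 0 < q) (hq1 : q < 1) (hs : 0 < s)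
    (hb : -(q ^ 2)⁻¹ < b)
    (hL : ActsOnMonomials L lam nu) (hlam : ∀ n m : ℕ, n ≠ m → lam n ≠ lam m)
    (hnu0 : nu 0 = 0) (hnu1 : nu 1 = 0) (hnu : ∀ n : ℕ, 2 ≤ n → nu n ≠ 0)
    (hP : IsMonicEigenfamily L lam P) : IsPositiveDefiniteOPS P := by
  refine hP.isPositiveDefiniteOPS_of_hasSymmetricRecurrence hL hlam hnu0 hnu1
    (h.hasSymmetricRecurrence hq hq1 hL hlam hnu0 hnu1 hnu hP) (fun n => ?_) fun n => ?_
  · exact mul_pos hs (div_pos (sub_pos.2 (pow_lt_one₀ hq.le hq1 (by omega))) (by positivity))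
  · refine mul_pos hs (div_pos ?_ (by positivity))
    have h1 : -1 < b * q ^ 2 := by
      have := mul_lt_mul_of_pos_right hb (show 0 < q ^ 2 by positivity)
      rwa [neg_mul, inv_mul_cancel₀ (by positivity)] at this
    have h0 : 0 < q ^ (2 * n) := by positivity
    have h2 : q ^ (2 * n) ≤ 1 := pow_le_one₀ hq.le hq1.le
    rw [pow_add]
    nlinarith [mul_lt_mul_of_pos_right h1 h0]

theorem IsJacobiType.isPositiveDefiniteOPS
    (h : IsJacobiType lam nu a b s κ ρ ε₀ ε₁) (hs : 0 < s) (hb : -2 < b) (hab : b < a)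
    (hL : ActsOnMonomials L lam nu) (hlam : ∀ n m : ℕ, n ≠ m → lam n ≠ lam m)
    (hnu0 : nu 0 = 0) (hnu1 : nu 1 = 0) (hnu : ∀ n : ℕ, 2 ≤ n → nu n ≠ 0)
    (hP : IsMonicEigenfamily L lam P) : IsPositiveDefiniteOPS P := by
  refine hP.isPositiveDefiniteOPS_of_hasSymmetricRecurrence hL hlam hnu0 hnu1
    (h.hasSymmetricRecurrence hL hlam hnu0 hnu1 hnu hP) (fun n => ?_) fun n => ?_
  · have hn : (0 : ℝ) ≤ n := n.cast_nonneg
    refine mul_pos hs ?_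
    rw [uJacobiEven]
    push_cast
    refine div_pos (mul_pos ?_ ?_) (mul_pos ?_ ?_) <;> linarith
  · refine mul_pos hs ?_
    rw [uJacobiOdd]
    split_ifs with h0
    · exact div_pos (by linarith) (by linarith)
    · have hn : (1 : ℝ) ≤ n := by exact_mod_cast Nat.one_le_iff_ne_zero.2 h0
      refine div_pos (mul_pos ?_ ?_) (mul_pos ?_ ?_) <;> linarith

theorem IsLaguerreType.isPositiveDefiniteOPS
    (h : IsLaguerreType lam nu b s κ ρ ε₀ ε₁) (hs : 0 < s) (hb : -2 < b)
    (hL : ActsOnMonomials L lam nu) (hlam : ∀ n m : ℕ, n ≠ m → lam n ≠ lam m)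
    (hnu0 : nu 0 = 0) (hnu1 : nu 1 = 0) (hnu : ∀ n : ℕ, 2 ≤ n → nu n ≠ 0)
    (hP : IsMonicEigenfamily L lam P) : IsPositiveDefiniteOPS P := by
  refine hP.isPositiveDefiniteOPS_of_hasSymmetricRecurrence hL hlam hnu0 hnu1
    (h.hasSymmetricRecurrence hL hlam hnu0 hnu1 hnu hP) (fun n => ?_) fun n => ?_
  · refine mul_pos hs ?_
    rw [uLaguerreEven]
    positivity
  · refine mul_pos hs ?_
    have hn : (0 : ℝ) ≤ n := n.cast_nonneg
    rw [uLaguerreOdd]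
    linarith

end Sufficiency

/-! ### Symmetry of the operator and relations between moments -/

section Moments

variable {L : ℝ[X] →ₗ[ℝ] ℝ[X]} {lam nu : ℕ → ℝ} {P : ℕ → ℝ[X]} {σ : ℝ[X] →ₗ[ℝ] ℝ}

/-- In the basis `P_n` the operator and the bilinear form are both diagonal. -/
theorem IsMonicEigenfamily.map_mul_comm (hP : IsMonicEigenfamily L lam P)
    (hσ : IsOrthogonalFor σ P) (p r : ℝ[X]) : σ (L p * r) = σ (p * L r) := by
  have h1 : ∀ n m, σ (L (P n) * P m) = σ (P n * L (P m)) := fun n m => by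
    rw [(hP n).2.2, (hP m).2.2, mul_assoc, map_C_mul, mul_left_comm, map_C_mul]
    rcases eq_or_ne n m with rfl | hnm
    · rfl
    · rw [hσ n m hnm, mul_zero, mul_zero]
  have h2 : ∀ m, σ ∘ₗ LinearMap.mulRight ℝ (P m) ∘ₗ L = σ ∘ₗ LinearMap.mulRight ℝ (L (P m)) :=
    fun m => hP.basis.ext fun n => by
      rw [hP.basis_apply]
      exact h1 n m
  have h3 : σ ∘ₗ LinearMap.mulLeft ℝ (L p) = σ ∘ₗ LinearMap.mulLeft ℝ p ∘ₗ L :=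
    hP.basis.ext fun m => by
      rw [hP.basis_apply]
      exact LinearMap.congr_fun (h2 m) p
  exact LinearMap.congr_fun h3 r

theorem IsMonicEigenfamily.moment_relation (hP : IsMonicEigenfamily L lam P)
    (hσ : IsOrthogonalFor σ P) (hL : ActsOnMonomials L lam nu) (hnu0 : nu 0 = 0)
    (hnu1 : nu 1 = 0) (n m : ℕ) :
    (lam n - lam m) * σ (X ^ (n + m)) + (nu n - nu m) * σ (X ^ (n + m - 2)) = 0 := by
  have key : ∀ n m, σ (L (X ^ n) * X ^ m) =
      lam n * σ (X ^ (n + m)) + nu n * σ (X ^ (n + m - 2)) := fun n m => by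
    rw [hL n, add_mul, map_add, mul_assoc, mul_assoc, map_C_mul, map_C_mul, ← pow_add, ← pow_add]
    rcases n with _ | _ | n
    · rw [hnu0, zero_mul, zero_mul]
    · rw [hnu1, zero_mul, zero_mul]
    · rw [show n + 1 + 1 - 2 + m = n + 1 + 1 + m - 2 by omega]
  have h := hP.map_mul_comm hσ (X ^ n) (X ^ m)
  rw [mul_comm (X ^ n), key, key, add_comm m n] at h
  linear_combination h

theorem IsMonicEigenfamily.moment_relation_even (hP : IsMonicEigenfamily L lam P)
    (hσ : IsOrthogonalFor σ P) (hL : ActsOnMonomials L lam nu) (hnu0 : nu 0 = 0)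
    (hnu1 : nu 1 = 0) (i j k : ℕ) (h : i + j = k + 1) :
    (lam (2 * i) - lam (2 * j)) * σ (X ^ (2 * (k + 1))) +
      (nu (2 * i) - nu (2 * j)) * σ (X ^ (2 * k)) = 0 := by
  have e := hP.moment_relation hσ hL hnu0 hnu1 (2 * i) (2 * j)
  rwa [show 2 * i + 2 * j - 2 = 2 * k by omega, show 2 * i + 2 * j = 2 * (k + 1) by omega] at e

theorem IsMonicEigenfamily.moment_relation_odd (hP : IsMonicEigenfamily L lam P)
    (hσ : IsOrthogonalFor σ P) (hL : ActsOnMonomials L lam nu) (hnu0 : nu 0 = 0)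
    (hnu1 : nu 1 = 0) (i j : ℕ) :
    (lam (2 * i + 1) - lam (2 * j + 1)) * σ (X ^ (2 * (i + j + 1))) +
      (nu (2 * i + 1) - nu (2 * j + 1)) * σ (X ^ (2 * (i + j))) = 0 := by
  have e := hP.moment_relation hσ hL hnu0 hnu1 (2 * i + 1) (2 * j + 1)
  rwa [show 2 * i + 1 + (2 * j + 1) - 2 = 2 * (i + j) by omega,
    show 2 * i + 1 + (2 * j + 1) = 2 * (i + j + 1) by omega] at e

theorem IsPositiveDefiniteFunctional.moment_pos (hσ : IsPositiveDefiniteFunctional σ) (k : ℕ) :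
    0 < σ (X ^ (2 * k)) := by
  rw [two_mul, pow_add]
  exact hσ _ (pow_ne_zero _ X_ne_zero)

theorem IsPositiveDefiniteFunctional.moment_ratio_strictMono
    (hσ : IsPositiveDefiniteFunctional σ) :
    StrictMono fun k => σ (X ^ (2 * (k + 1))) / σ (X ^ (2 * k)) := by
  refine strictMono_nat_of_lt_succ fun k => ?_
  have h0 := hσ.moment_pos k
  have h1 := hσ.moment_pos (k + 1)
  set c0 := σ (X ^ (2 * k)) with hc0
  set c1 := σ (X ^ (2 * (k + 1))) with hc1
  set c2 := σ (X ^ (2 * (k + 1 + 1))) with hc2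
  -- The residual of projecting `x^{k+2}` on `x^k`; its positive square norm is strict
  -- Cauchy–Schwarz, `c1² < c0 c2`.
  have hne : (X ^ (k + 2) - C (c1 / c0) * X ^ k : ℝ[X]) ≠ 0 := fun h => by
    have := congrArg (fun p => p.coeff (k + 2)) h
    simp [coeff_X_pow] at this
  have h := hσ _ hne
  have e : (X ^ (k + 2) - C (c1 / c0) * X ^ k : ℝ[X]) * (X ^ (k + 2) - C (c1 / c0) * X ^ k) =
      X ^ (2 * (k + 1 + 1)) - C (c1 / c0) * X ^ (2 * (k + 1)) - C (c1 / c0) * X ^ (2 * (k + 1)) +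
        C (c1 / c0) * (C (c1 / c0) * X ^ (2 * k)) := by ring
  rw [e, map_add, map_sub, map_sub, map_C_mul, map_C_mul, map_C_mul, ← hc0, ← hc1, ← hc2] at h
  rw [lt_div_iff₀ h1]
  have : c1 / c0 * (c1 / c0 * c0) = c1 / c0 * c1 := by field_simp
  linarith

end Moments

/-! ### From slopes to bracket type -/

section Classification

variable {f g f' g' t φ : ℕ → ℝ} {θ y : ℝ}

/-- Slopes of the three chords of a triangle: the increments of `g` over two consecutive steps add
up to that over the double step. -/
theorem slope_relation (he : ∀ i j k, i + j = k + 1 → g i - g j = -t k * (f i - f j)) (n : ℕ) :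
    (t (2 * n + 1) - t (2 * n)) * (f (n + 1) - f n) =
      (t (2 * n + 2) - t (2 * n + 1)) * (f (n + 2) - f (n + 1)) := by
  have h1 := he (n + 1) n (2 * n) (by ring)
  have h2 := he (n + 2) (n + 1) (2 * n + 2) (by ring)
  have h3 := he (n + 2) n (2 * n + 1) (by ring)
  linear_combination h3 - h1 - h2

theorem differences_mul_pos (ht : StrictMono t) (hf : f.Injective)
    (he : ∀ i j k, i + j = k + 1 → g i - g j = -t k * (f i - f j)) (n : ℕ) :
    0 < (f (n + 1) - f n) * (f (n + 2) - f (n + 1)) := by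
  have h := slope_relation he n
  have h1 : t (2 * n) < t (2 * n + 1) := ht (by omega)
  have h2 : t (2 * n + 1) < t (2 * n + 2) := ht (by omega)
  have h3 : f (n + 2) - f (n + 1) ≠ 0 := sub_ne_zero.2 (hf.ne (by omega))
  have h4 : 0 < (t (2 * n + 1) - t (2 * n)) * ((f (n + 1) - f n) * (f (n + 2) - f (n + 1))) := by
    rw [← mul_assoc, h, mul_assoc]
    exact mul_pos (sub_pos.2 h2) (mul_self_pos.2 h3)
  exact pos_of_mul_pos_right h4 (sub_pos.2 h1).le

/-- Chords with equal `i + j` are parallel, so the ratio `y n` defined by `f` also serves for `g`.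
-/
theorem exists_difference_relation (ht : StrictMono t) (hf : f.Injective)
    (he : ∀ i j k, i + j = k + 1 → g i - g j = -t k * (f i - f j)) :
    ∃ y, ∀ n, (f (n + 3) - f (n + 2)) + (f (n + 1) - f n) = y * (f (n + 2) - f (n + 1)) ∧
      (g (n + 3) - g (n + 2)) + (g (n + 1) - g n) = y * (g (n + 2) - g (n + 1)) := by
  have hne : ∀ n, f (n + 1) - f n ≠ 0 := fun n => sub_ne_zero.2 (hf.ne (by omega))
  choose y hy using fun n => (⟨((f (n + 3) - f (n + 2)) + (f (n + 1) - f n)) /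
    (f (n + 2) - f (n + 1)), (div_mul_cancel₀ _ (hne (n + 1))).symm⟩ :
    ∃ y, (f (n + 3) - f (n + 2)) + (f (n + 1) - f n) = y * (f (n + 2) - f (n + 1)))
  have hg : ∀ n, (g (n + 3) - g (n + 2)) + (g (n + 1) - g n) = y n * (g (n + 2) - g (n + 1)) :=
    fun n => by
      have h1 := he (n + 3) n (2 * n + 2) (by ring)
      have h2 := he (n + 2) (n + 1) (2 * n + 2) (by ring)
      linear_combination h1 - (1 + y n) * h2 - t (2 * n + 2) * hy n
  -- Adding the relations for `n` and `n + 1` gives `f(n+4) - f(n) = y(n+1)(f(n+3) - f(n+1)) + (y(n)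
  -- - y(n+1))(f(n+2) - f(n+1))`, and the same for `g`. The first two chords have slope `-t(2n+3)`,
  -- the last `-t(2n+2)`, so its factor must vanish.
  have hstep : ∀ n, y (n + 1) = y n := fun n => by
    have h1 := he (n + 4) n (2 * n + 3) (by ring)
    have h2 := he (n + 3) (n + 1) (2 * n + 3) (by ring)
    have h3 := he (n + 2) (n + 1) (2 * n + 2) (by ring)
    have a1 := hy n
    have a2 := hy (n + 1)
    have b1 := hg n
    have b2 := hg (n + 1)
    have hlt : t (2 * n + 2) < t (2 * n + 3) := ht (by omega)
    have hz : (t (2 * n + 3) - t (2 * n + 2)) * (f (n + 2) - f (n + 1)) ≠ 0 :=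
      mul_ne_zero (sub_pos.2 hlt).ne' (hne (n + 1))
    simp only [add_assoc] at a2 b2
    norm_num at a2 b2
    apply mul_left_cancel₀ hz
    linear_combination h2 - h1 + b1 + b2 + t (2 * n + 3) * (a1 + a2) + (y (n + 1) - 1) * h2 +
      (y n - y (n + 1)) * h3
  have hconst : ∀ n, y n = y 0 := fun n => by
    induction n with
    | zero => rfl
    | succ n ih => rw [hstep, ih]
  exact ⟨y 0, fun n => ⟨by rw [hy n, hconst n], by rw [hg n, hconst n]⟩⟩

/-- The positive ratios `r` of consecutive terms obey `r' = y - 1/r ≤ r - (2 - y)`, since `r + 1/r ≥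
2`. For `y < 2` they would decrease below zero. -/
theorem two_le_of_difference_relation (hpos : ∀ n, 0 < φ n * φ (n + 1))
    (hrec : ∀ n, φ (n + 2) + φ n = y * φ (n + 1)) : 2 ≤ y := by
  by_contra! hy
  have hne : ∀ n, φ n ≠ 0 := fun n h => by
    have := hpos n; rw [h, zero_mul] at this; exact lt_irrefl _ this
  have hr : ∀ n, 0 < φ (n + 1) / φ n := fun n => by
    have : φ (n + 1) / φ n = φ n * φ (n + 1) / (φ n * φ n) := by
      have := hne n; field_simp
    rw [this]
    exact div_pos (hpos n) (mul_self_pos.2 (hne n))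
  have hstep : ∀ n, φ (n + 2) / φ (n + 1) ≤ φ (n + 1) / φ n - (2 - y) := fun n => by
    have h1 : φ (n + 2) / φ (n + 1) = y - (φ (n + 1) / φ n)⁻¹ := by
      have h2 := hne n
      have h3 := hne (n + 1)
      field_simp
      linear_combination hrec n
    have h4 : 2 ≤ φ (n + 1) / φ n + (φ (n + 1) / φ n)⁻¹ := by
      have h5 := hr n
      generalize φ (n + 1) / φ n = r at h5
      have h6 : r + r⁻¹ - 2 = (r - 1) ^ 2 / r := by field_simp; ring
      have : 0 ≤ (r - 1) ^ 2 / r := by positivity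
      linarith
    linarith
  have hbound : ∀ n : ℕ, φ (n + 1) / φ n ≤ φ 1 / φ 0 - n * (2 - y) := fun n => by
    induction n with
    | zero => simp
    | succ n ih => push_cast; linarith [hstep n]
  obtain ⟨n, hn⟩ := exists_nat_gt (φ 1 / φ 0 / (2 - y))
  rw [div_lt_iff₀ (by linarith)] at hn
  linarith [hbound n, hr n]

theorem exists_add_inv_eq (hy : 2 ≤ y) : ∃ θ : ℝ, 0 < θ ∧ θ ≤ 1 ∧ θ + θ⁻¹ = y := by
  have h0 : 0 ≤ y ^ 2 - 4 := by nlinarith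
  have hs := Real.sq_sqrt h0
  have hs0 := Real.sqrt_nonneg (y ^ 2 - 4)
  generalize √(y ^ 2 - 4) = r at hs hs0
  have hlt : r < y := by nlinarith
  have hle : y - 2 ≤ r := by nlinarith
  refine ⟨(y - r) / 2, by linarith, by linarith, ?_⟩
  have : (y - r) ≠ 0 := by linarith
  field_simp
  linear_combination hs

/-- The common shape of the coefficients of bracket type. -/
noncomputable def bracketForm (θ d₀ d₁ : ℝ) (n : ℕ) : ℝ :=
  (θ ^ n)⁻¹ * bracket θ n * bracketLin θ d₀ d₁ n

theorem bracketForm_rec (hθ : θ ≠ 0) (d₀ d₁ : ℝ) (n : ℕ) :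
    (bracketForm θ d₀ d₁ (n + 3) - bracketForm θ d₀ d₁ (n + 2)) +
      (bracketForm θ d₀ d₁ (n + 1) - bracketForm θ d₀ d₁ n) =
      (θ + θ⁻¹) * (bracketForm θ d₀ d₁ (n + 2) - bracketForm θ d₀ d₁ (n + 1)) := by
  have h1 := pow_ne_zero n hθ
  have e2 : bracket θ 2 = 1 + θ := by simp [bracket, Finset.sum_range_succ]
  have e3 : bracket θ 3 = 1 + θ + θ ^ 2 := by simp [bracket, Finset.sum_range_succ]
  simp only [bracketForm, bracketLin, bracket_add, pow_add, e2, e3, bracket_one_right]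
  field_simp
  rw [pow_eq_bracket θ n]
  ring

/-- Sums of neighbouring even terms describe the odd coefficients; this accounts for the argument `n
+ 1` of `D` and `N` there. -/
theorem bracketForm_add_succ (hθ : θ ≠ 0) (d₀ d₁ : ℝ) (n : ℕ) :
    bracketForm θ d₀ d₁ n + bracketForm θ d₀ d₁ (n + 1) - bracketForm θ d₀ d₁ 1 =
      (1 + θ⁻¹) * ((θ ^ n)⁻¹ * bracket θ n * bracketLin θ d₀ d₁ (n + 1)) := by
  have h1 := pow_ne_zero n hθ
  simp only [bracketForm, bracketLin, bracket_add, pow_add, bracket_one_right, pow_one]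
  field_simp
  rw [pow_eq_bracket θ n]
  ring

theorem exists_eq_bracketForm (hθ : 0 < θ) {F : ℕ → ℝ} (h0 : F 0 = 0)
    (hrec : ∀ n, (F (n + 3) - F (n + 2)) + (F (n + 1) - F n) =
      (θ + θ⁻¹) * (F (n + 2) - F (n + 1))) :
    ∃ d₀ d₁, ∀ n, F n = bracketForm θ d₀ d₁ n := by
  have hθ' : 1 + θ ≠ 0 := by positivity
  have e2 : bracket θ 2 = 1 + θ := by simp [bracket, Finset.sum_range_succ]
  -- Solved from `D(1) = θ F(1)` and `D(2) = θ² F(2) / (1 + θ)`, with `D(2) - D(1) = d₁ θ`.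
  refine ⟨θ * F 1 - (θ ^ 2 * F 2 / (1 + θ) - θ * F 1) / θ,
    (θ ^ 2 * F 2 / (1 + θ) - θ * F 1) / θ, fun n => ?_⟩
  induction n using Nat.strong_induction_on with
  | _ n ih =>
    rcases n with _ | _ | _ | n
    · simp [h0, bracketForm]
    · simp only [bracketForm, bracketLin, zero_add, bracket_one_right]
      field_simp
      ring
    · simp only [bracketForm, bracketLin, zero_add, one_add_one_eq_two, e2]
      field_simp
      ring
    · have h1 := hrec n
      rw [ih n (by omega), ih (n + 1) (by omega), ih (n + 2) (by omega)] at h1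
      have h2 := bracketForm_rec hθ.ne' (θ * F 1 - (θ ^ 2 * F 2 / (1 + θ) - θ * F 1) / θ)
        ((θ ^ 2 * F 2 / (1 + θ) - θ * F 1) / θ) n
      linear_combination h1 - h2

/-- The increments `f'(n+1) - f'(n)` and `f(n+2) - f(n)` belong to the same slope `-t(2n+1)` and
satisfy the same first-order recursion, so they are proportional. -/
theorem exists_odd_proportional (ht : StrictMono t) (hf : f.Injective)
    (he : ∀ i j k, i + j = k + 1 → g i - g j = -t k * (f i - f j))
    (ho : ∀ i j, g' i - g' j = -t (i + j) * (f' i - f' j)) :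
    ∃ c, ∀ n, f' n - f' 0 = c * (f n + f (n + 1) - f 0 - f 1) ∧
      g' n - g' 0 = c * (g n + g (n + 1) - g 0 - g 1) := by
  have h0 : f 2 - f 0 ≠ 0 := sub_ne_zero.2 (hf.ne (by omega))
  obtain ⟨c, hc⟩ : ∃ c, f' 1 - f' 0 = c * (f 2 - f 0) :=
    ⟨(f' 1 - f' 0) / (f 2 - f 0), (div_mul_cancel₀ _ h0).symm⟩
  have hstep : ∀ n, f' (n + 1) - f' n = c * (f (n + 2) - f n) := fun n => by
    induction n with
    | zero => exact hc
    | succ n ih =>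
      have a1 := ho (n + 1) n
      have a2 := ho (n + 2) (n + 1)
      have a3 := ho (n + 2) n
      have b1 := he (n + 2) n (2 * n + 1) (by ring)
      have b2 := he (n + 3) (n + 1) (2 * n + 3) (by ring)
      have b3 := he (n + 3) n (2 * n + 2) (by ring)
      have b4 := he (n + 2) (n + 1) (2 * n + 2) (by ring)
      rw [show n + 1 + n = 2 * n + 1 by ring] at a1
      rw [show n + 2 + (n + 1) = 2 * n + 3 by ring] at a2
      rw [show n + 2 + n = 2 * n + 2 by ring] at a3
      have hlt : t (2 * n + 2) < t (2 * n + 3) := ht (by omega)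
      apply mul_left_cancel₀ (sub_pos.2 hlt).ne'
      linear_combination (t (2 * n + 2) - t (2 * n + 1)) * ih + (a1 + a2 - a3)
        - c * (b1 + b2 - b3 - b4)
  have hstep' : ∀ n, g' (n + 1) - g' n = c * (g (n + 2) - g n) := fun n => by
    have a1 := ho (n + 1) n
    have b1 := he (n + 2) n (2 * n + 1) (by ring)
    rw [show n + 1 + n = 2 * n + 1 by ring] at a1
    linear_combination a1 - c * b1 - t (2 * n + 1) * hstep n
  refine ⟨c, fun n => ?_⟩
  induction n with
  | zero => constructor <;> ring
  | succ n ih =>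
    exact ⟨by linear_combination ih.1 + hstep n, by linear_combination ih.2 + hstep' n⟩

theorem exists_isBracketType {lam nu : ℕ → ℝ} (ht : StrictMono t)
    (hlam : ∀ n m : ℕ, n ≠ m → lam n ≠ lam m) (hnu0 : nu 0 = 0) (hnu1 : nu 1 = 0)
    (he : ∀ i j k, i + j = k + 1 →
      nu (2 * i) - nu (2 * j) = -t k * (lam (2 * i) - lam (2 * j)))
    (ho : ∀ i j, nu (2 * i + 1) - nu (2 * j + 1) =
      -t (i + j) * (lam (2 * i + 1) - lam (2 * j + 1))) :
    ∃ θ d₀ d₁ n₀ n₁ ρ ε₀ ε₁ : ℝ, 0 < θ ∧ θ ≤ 1 ∧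
      IsBracketType lam nu θ d₀ d₁ n₀ n₁ ρ ε₀ ε₁ := by
  have hf : (fun n => lam (2 * n)).Injective := fun i j hij => by
    by_contra hne
    exact hlam _ _ (by omega) hij
  obtain ⟨y, hy⟩ := exists_difference_relation (f := fun n => lam (2 * n))
    (g := fun n => nu (2 * n)) ht hf he
  have hy2 : 2 ≤ y := two_le_of_difference_relation
    (φ := fun n => lam (2 * (n + 1)) - lam (2 * n))
    (fun n => differences_mul_pos ht hf he n) fun n => (hy n).1
  obtain ⟨θ, hθ, hθ1, rfl⟩ := exists_add_inv_eq hy2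
  obtain ⟨d₀, d₁, hd⟩ := exists_eq_bracketForm hθ (F := fun n => lam (2 * n) - lam 0)
    (by simp) fun n => by linear_combination (hy n).1
  obtain ⟨n₀, n₁, hn⟩ := exists_eq_bracketForm hθ (F := fun n => -nu (2 * n))
    (by simp [hnu0]) fun n => by linear_combination -(hy n).2
  obtain ⟨c, hc⟩ := exists_odd_proportional (f := fun n => lam (2 * n))
    (g := fun n => nu (2 * n)) (f' := fun n => lam (2 * n + 1)) (g' := fun n => nu (2 * n + 1))
    ht hf he ho
  refine ⟨θ, d₀, d₁, n₀, n₁, -(c * (1 + θ⁻¹)), lam 0, lam 1, hθ, hθ1, fun n => ?_⟩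
  have A := bracketForm_add_succ hθ.ne' d₀ d₁ n
  have B := bracketForm_add_succ hθ.ne' n₀ n₁ n
  have d1 := hd n
  have d2 := hd (n + 1)
  have d3 := hd 1
  have m1 := hn n
  have m2 := hn (n + 1)
  have m3 := hn 1
  obtain ⟨c1, c2⟩ := hc n
  simp only [mul_zero, zero_add, hnu0, hnu1] at c1 c2 d1 d2 d3 m1 m2 m3
  refine ⟨?_, ?_, ?_, ?_⟩
  · rw [bracketForm] at d1
    linear_combination d1
  · linear_combination c1 + c * (A + d1 + d2 - d3)
  · rw [bracketForm] at m1
    linear_combination -m1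
  · linear_combination c2 - c * (B + m1 + m2 - m3)

end Classification

/-! ### Identification of the four families and their parameter ranges -/

section Necessity

open Filter Topology

variable {L : ℝ[X] →ₗ[ℝ] ℝ[X]} {lam nu : ℕ → ℝ} {P : ℕ → ℝ[X]} {σ : ℝ[X] →ₗ[ℝ] ℝ}
  {t : ℕ → ℝ} {q a b s κ θ d₀ d₁ n₀ n₁ ρ ε₀ ε₁ : ℝ}

theorem one_add_mul_pow_pos (hq : 0 < q) (hq1 : q < 1) (ha : 0 < 1 + a * q ^ 2) {k : ℕ}
    (hk : 2 ≤ k) : 0 < 1 + a * q ^ k := by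
  have hk1 : q ^ k ≤ q ^ 2 := pow_le_pow_of_le_one hq.le hq1.le hk
  have hk0 : 0 < q ^ k := by positivity
  rcases le_or_gt 0 a with h | h
  · positivity
  · nlinarith [mul_le_mul_of_nonpos_left hk1 h.le]

/-- The sign of `u_{2n}` is that of `a q^{2n-2} - b`, which tends to `-b`. -/
theorem IsLittleQJacobiType.nonpos_of_isPositiveDefiniteFunctional
    (h : IsLittleQJacobiType lam nu q a b s κ ρ ε₀ ε₁) (hq : 0 < q) (hq1 : q < 1) (hs : 0 < s)
    (ha : 0 < 1 + a * q ^ 2)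
    (hL : ActsOnMonomials L lam nu) (hlam : ∀ n m : ℕ, n ≠ m → lam n ≠ lam m)
    (hnu0 : nu 0 = 0) (hnu1 : nu 1 = 0) (hnu : ∀ n : ℕ, 2 ≤ n → nu n ≠ 0)
    (hP : IsMonicEigenfamily L lam P)
    (hσ : IsOrthogonalFor σ P) (hpos : IsPositiveDefiniteFunctional σ) : b ≤ 0 := by
  have hn : ∀ n : ℕ, 0 ≤ a * (q ^ 2) ^ n - b := fun n => by
    have hu := hP.even_pos_of_hasSymmetricRecurrence hL hlam hnu0 hnu1
      (h.hasSymmetricRecurrence hq hq1 hL hlam hnu0 hnu1 hnu hP) hσ hpos n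
    rw [uQJacobiEven, show 2 * (n + 1) - 2 = 2 * n by omega] at hu
    have h1 := one_add_mul_pow_pos hq hq1 ha (show 2 ≤ 4 * (n + 1) by omega)
    have h2 := one_add_mul_pow_pos hq hq1 ha (show 2 ≤ 4 * (n + 1) - 2 by omega)
    have h3 := (div_pos_iff_of_pos_right (mul_pos h1 h2)).1 (pos_of_mul_pos_right hu hs.le)
    have h4 : 0 < 1 - q ^ (2 * (n + 1)) := sub_pos.2 (pow_lt_one₀ hq.le hq1 (by omega))
    have h5 := pos_of_mul_pos_right h3 (mul_pos (by positivity) h4).le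
    rw [pow_mul] at h5
    exact h5.le
  have hQ : q ^ 2 < 1 := pow_lt_one₀ hq.le hq1 two_ne_zero
  have hlim : Tendsto (fun n : ℕ => a * (q ^ 2) ^ n - b) atTop (𝓝 (a * 0 - b)) :=
    ((tendsto_pow_atTop_nhds_zero_of_lt_one (by positivity) hQ).const_mul a).sub_const b
  have := ge_of_tendsto' hlim hn
  linarith

/-- The chord from the point of index 0: `t_k = N(k+1) / D(k+1)`. -/
theorem IsBracketType.num_eq (h : IsBracketType lam nu θ d₀ d₁ n₀ n₁ ρ ε₀ ε₁) (hθ : 0 < θ)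
    (he : ∀ i j k, i + j = k + 1 →
      nu (2 * i) - nu (2 * j) = -t k * (lam (2 * i) - lam (2 * j))) (k : ℕ) :
    bracketLin θ n₀ n₁ (k + 1) = t k * bracketLin θ d₀ d₁ (k + 1) := by
  have e := he (k + 1) 0 k rfl
  rw [(h (k + 1)).2.2.1, (h 0).2.2.1, (h (k + 1)).1, (h 0).1, bracket_zero] at e
  have h1 : (θ ^ (k + 1))⁻¹ * bracket θ (k + 1) ≠ 0 :=
    mul_ne_zero (inv_ne_zero (pow_ne_zero _ hθ.ne')) (bracket_ne_zero hθ (by omega))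
  apply mul_left_cancel₀ h1
  linear_combination -e

/-- `λ_{2n+2} - λ_{2n}` is a positive multiple of `D(2n+1)`, and these increments share one sign. -/
theorem IsBracketType.den_mul_pos (h : IsBracketType lam nu θ d₀ d₁ n₀ n₁ ρ ε₀ ε₁) (hθ : 0 < θ)
    (ht : StrictMono t) (hlam : ∀ n m : ℕ, n ≠ m → lam n ≠ lam m)
    (he : ∀ i j k, i + j = k + 1 →
      nu (2 * i) - nu (2 * j) = -t k * (lam (2 * i) - lam (2 * j))) (n : ℕ) :
    0 < bracketLin θ d₀ d₁ 1 * bracketLin θ d₀ d₁ (2 * n + 1) := by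
  have hf : (fun n => lam (2 * n)).Injective := fun i j hij => by
    by_contra hne
    exact hlam _ _ (by omega) hij
  induction n with
  | zero => exact mul_self_pos.2 (h.den_ne_zero hlam one_ne_zero)
  | succ n ih =>
    have hp := differences_mul_pos ht hf he n
    have e1 := h.lam_even_sub hθ n 1
    have e2 := h.lam_even_sub hθ (n + 1) 1
    rw [bracket_one_right, mul_one] at e1 e2
    rw [e1, e2] at hp
    rw [show 2 * (n + 1) + 1 = 2 * n + 1 + 2 by ring] at hp ⊢
    have hx : 0 < (θ ^ (n + 1))⁻¹ * (θ ^ (n + 1 + 1))⁻¹ := by positivity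
    have hp' : 0 < ((θ ^ (n + 1))⁻¹ * (θ ^ (n + 1 + 1))⁻¹) *
        (bracketLin θ d₀ d₁ (2 * n + 1) * bracketLin θ d₀ d₁ (2 * n + 1 + 2)) := lt_of_lt_of_eq hp (by ring)
    have hy := pos_of_mul_pos_right hp' hx.le
    have hz := mul_pos ih hy
    have hw : 0 < (bracketLin θ d₀ d₁ 1 * bracketLin θ d₀ d₁ (2 * n + 1 + 2)) *
        (bracketLin θ d₀ d₁ (2 * n + 1) * bracketLin θ d₀ d₁ (2 * n + 1)) := lt_of_lt_of_eq hz (by ring)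
    exact pos_of_mul_pos_left hw (mul_self_nonneg _)

theorem exists_bracketLin_eq (hθ : θ ≠ 1) (d₀ d₁ : ℝ) :
    ∃ A B, ∀ k, bracketLin θ d₀ d₁ k = A + B * θ ^ k := by
  have : 1 - θ ≠ 0 := sub_ne_zero.2 hθ.symm
  refine ⟨d₀ + d₁ / (1 - θ), -(d₁ / (1 - θ)), fun k => ?_⟩
  rw [bracketLin, pow_eq_bracket θ k]
  field_simp
  ring

theorem IsBracketType.exists_isQLaguerreType {B A' B' : ℝ}
    (h : IsBracketType lam nu (q ^ 2) d₀ d₁ n₀ n₁ ρ ε₀ ε₁) (hq : 0 < q) (hq1 : q < 1)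
    (ht : StrictMono t) (htpos : ∀ k, 0 < t k) (hρ : ρ ≠ 0)
    (hD0 : bracketLin (q ^ 2) d₀ d₁ 1 ≠ 0)
    (hD : ∀ k, bracketLin (q ^ 2) d₀ d₁ k = B * (q ^ 2) ^ k)
    (hN : ∀ k, bracketLin (q ^ 2) n₀ n₁ k = A' + B' * (q ^ 2) ^ k)
    (hrel : ∀ k, bracketLin (q ^ 2) n₀ n₁ (k + 1) = t k * bracketLin (q ^ 2) d₀ d₁ (k + 1)) :
    ∃ q b s κ ρ ε₀ ε₁ : ℝ, 0 < q ∧ q < 1 ∧ 0 < s ∧ κ ≠ 0 ∧ ρ ≠ 0 ∧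
      -(q ^ 2)⁻¹ < b ∧ IsQLaguerreType lam nu q b s κ ρ ε₀ ε₁ := by
  have hQ : q ^ 2 < 1 := pow_lt_one₀ hq.le hq1 two_ne_zero
  have hQ' : 1 - q ^ 2 ≠ 0 := by linarith
  have hB : B ≠ 0 := by
    rintro rfl
    exact hD0 (by rw [hD, zero_mul])
  simp only [hD, hN] at hrel
  have e0 := hrel 0
  have e1 := hrel 1
  have hlt := ht zero_lt_one
  -- Here `t_k = (A'/B) θ^{-(k+1)} + B'/B`, so growth of `t` is positivity of `s = A'/B`.
  have hs : 0 < A' / B := by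
    have : t 1 - t 0 = A' / B * ((1 - q ^ 2) / (q ^ 2) ^ 2) := by
      field_simp
      rw [zero_add, pow_one] at e0
      linear_combination (-e1 + q ^ 2 * e0)
    have h2 : 0 < A' / B * ((1 - q ^ 2) / (q ^ 2) ^ 2) := by linarith
    exact pos_of_mul_pos_left h2 (div_nonneg (by linarith) (by positivity))
  have hA' : A' ≠ 0 := by
    rintro rfl
    rw [zero_div] at hs
    exact lt_irrefl _ hs
  refine ⟨q, B' / A', A' / B, B / (1 - q ^ 2), -ρ * q ^ 2, ε₀, ε₁, hq, hq1, hs,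
    div_ne_zero hB hQ', mul_ne_zero (neg_ne_zero.2 hρ) (by positivity), ?_, fun n => ?_⟩
  · have : t 0 = A' / B * ((q ^ 2)⁻¹ + B' / A') := by
      field_simp
      rw [zero_add, pow_one] at e0
      linear_combination -e0
    have h2 : 0 < A' / B * ((q ^ 2)⁻¹ + B' / A') := this ▸ htpos 0
    have := pos_of_mul_pos_right h2 hs.le
    linarith
  · obtain ⟨h1, h2, h3, h4⟩ := h n
    have hp : (q ^ 2) ^ n ≠ 0 := by positivity
    have e : q ^ (2 * n + 2) = (q ^ 2) ^ n * q ^ 2 := by rw [pow_add, pow_mul]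
    rw [h1, h2, h3, h4, e]
    simp only [hD, hN, bracket_eq_div hQ.ne, pow_mul, pow_succ (q ^ 2) n]
    refine ⟨?_, ?_, ?_, ?_⟩ <;> field_simp <;> ring

/-- The dilation `s = A'/A` is the limit of `t`. The constant sign of `D(2n+1)`, which tends to `A`,
gives `1 + a q^2 > 0`. Then `0 < t_0` yields the lower bound for `b`, and `t_0 < s` yields `b < a`.
-/
theorem IsBracketType.exists_isLittleQJacobiType {A B A' B' : ℝ}
    (h : IsBracketType lam nu (q ^ 2) d₀ d₁ n₀ n₁ ρ ε₀ ε₁) (hq : 0 < q) (hq1 : q < 1)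
    (ht : StrictMono t) (htpos : ∀ k, 0 < t k) (hA : A ≠ 0)
    (hD0 : bracketLin (q ^ 2) d₀ d₁ 1 ≠ 0)
    (hD : ∀ k, bracketLin (q ^ 2) d₀ d₁ k = A + B * (q ^ 2) ^ k)
    (hN : ∀ k, bracketLin (q ^ 2) n₀ n₁ k = A' + B' * (q ^ 2) ^ k)
    (hD1 : ∀ n, 0 < bracketLin (q ^ 2) d₀ d₁ 1 * bracketLin (q ^ 2) d₀ d₁ (2 * n + 1))
    (hDne : ∀ k, k ≠ 0 → bracketLin (q ^ 2) d₀ d₁ k ≠ 0)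
    (hrel : ∀ k, bracketLin (q ^ 2) n₀ n₁ (k + 1) = t k * bracketLin (q ^ 2) d₀ d₁ (k + 1)) :
    ∃ a b s κ : ℝ, 0 < s ∧ κ ≠ 0 ∧ 0 < 1 + a * q ^ 2 ∧ -(q ^ 2)⁻¹ < b ∧ b < a ∧
      IsLittleQJacobiType lam nu q a b s κ ρ ε₀ ε₁ := by
  have hQ : q ^ 2 < 1 := pow_lt_one₀ hq.le hq1 two_ne_zero
  have hQ' : 1 - q ^ 2 ≠ 0 := by linarith
  have hQ0 : 0 < q ^ 2 := by positivity
  have hpow := tendsto_pow_atTop_nhds_zero_of_lt_one hQ0.le hQ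
  simp only [hD, hN] at hrel hD1 hDne hD0
  rw [pow_one] at hD0
  have hlim : Tendsto t atTop (𝓝 (A' / A)) := by
    have h1 : Tendsto (fun k : ℕ => (A' + B' * (q ^ 2) ^ (k + 1)) / (A + B * (q ^ 2) ^ (k + 1)))
        atTop (𝓝 ((A' + B' * 0) / (A + B * 0))) :=
      (((hpow.comp (tendsto_add_atTop_nat 1)).const_mul B').const_add A').div
        (((hpow.comp (tendsto_add_atTop_nat 1)).const_mul B).const_add A) (by simpa using hA)
    simp only [mul_zero, add_zero] at h1
    refine h1.congr fun k => ?_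
    rw [hrel, mul_div_cancel_right₀ _ (hDne _ (by omega))]
  have hts : t 0 < A' / A := (ht zero_lt_one).trans_le (ht.monotone.ge_of_tendsto hlim 1)
  have hs : 0 < A' / A := (htpos 0).trans hts
  have hA' : A' ≠ 0 := by
    rintro rfl
    rw [zero_div] at hs
    exact lt_irrefl _ hs
  have ha : 0 < 1 + B / A * q ^ 2 := by
    have h1 : Tendsto (fun n : ℕ => (A + B * (q ^ 2)) * (A + B * (q ^ 2) ^ (2 * n + 1)))
        atTop (𝓝 ((A + B * (q ^ 2)) * (A + B * 0))) := by
      refine Tendsto.const_mul _ (Tendsto.const_add _ (Tendsto.const_mul _ (hpow.comp ?_)))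
      exact tendsto_atTop_mono (fun n => show n ≤ 2 * n + 1 by omega) tendsto_id
    have h2 := ge_of_tendsto' h1 fun n => by simpa using (hD1 n).le
    rw [mul_zero, add_zero] at h2
    have h3 : 1 + B / A * q ^ 2 = (A + B * q ^ 2) * A / (A * A) := by field_simp
    rw [h3]
    exact div_pos (lt_of_le_of_ne h2 (mul_ne_zero hD0 hA).symm) (mul_self_pos.2 hA)
  have e0 : A' / A * (1 + B' / A' * q ^ 2) = t 0 * (1 + B / A * q ^ 2) := by
    have := hrel 0
    rw [zero_add, pow_one] at this
    field_simp
    linear_combination this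
  refine ⟨B / A, B' / A', A' / A, A / (1 - q ^ 2), hs, div_ne_zero hA hQ', ha, ?_, ?_, fun n => ?_⟩
  · have h1 : 0 < 1 + B' / A' * q ^ 2 :=
      pos_of_mul_pos_right (e0 ▸ mul_pos (htpos 0) ha) hs.le
    have h2 : (q ^ 2)⁻¹ + B' / A' = (1 + B' / A' * q ^ 2) / q ^ 2 := by field_simp
    have h3 : 0 < (q ^ 2)⁻¹ + B' / A' := h2 ▸ div_pos h1 hQ0
    linarith
  · have h1 : A' / A * (1 + B' / A' * q ^ 2) < A' / A * (1 + B / A * q ^ 2) :=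
      e0 ▸ mul_lt_mul_of_pos_right hts ha
    have h2 := lt_of_mul_lt_mul_left h1 hs.le
    exact lt_of_mul_lt_mul_right (by linarith) hQ0.le
  · obtain ⟨h1, h2, h3, h4⟩ := h n
    have hp : (q ^ 2) ^ n ≠ 0 := by positivity
    rw [h1, h2, h3, h4]
    simp only [hD, hN, bracket_eq_div hQ.ne, pow_mul, pow_succ (q ^ 2) n]
    refine ⟨?_, ?_, ?_, ?_⟩ <;> field_simp <;> ring

theorem IsBracketType.exists_isLaguerreType
    (h : IsBracketType lam nu 1 d₀ 0 n₀ n₁ ρ ε₀ ε₁)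
    (ht : StrictMono t) (htpos : ∀ k, 0 < t k) (hd : d₀ ≠ 0)
    (hrel : ∀ k, bracketLin 1 n₀ n₁ (k + 1) = t k * bracketLin 1 d₀ 0 (k + 1)) :
    ∃ b s κ : ℝ, 0 < s ∧ κ ≠ 0 ∧ -2 < b ∧ IsLaguerreType lam nu b s κ ρ ε₀ ε₁ := by
  simp only [bracketLin, bracket_one_left] at hrel
  have e0 := hrel 0
  have e1 := hrel 1
  push_cast at e0 e1
  have hs : 0 < n₁ / (2 * d₀) := by
    have : n₁ / (2 * d₀) = (t 1 - t 0) / 2 := by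
      field_simp
      linear_combination e1 - e0
    rw [this]
    linarith [ht zero_lt_one]
  have hn1 : n₁ ≠ 0 := by
    rintro rfl
    rw [zero_div] at hs
    exact lt_irrefl _ hs
  refine ⟨2 * n₀ / n₁, n₁ / (2 * d₀), -(d₀ / 2), hs,
    neg_ne_zero.2 (div_ne_zero hd two_ne_zero), ?_, fun n => ?_⟩
  · have h1 : n₁ / (2 * d₀) * (2 + 2 * n₀ / n₁) = t 0 := by
      field_simp
      linear_combination e0
    have := pos_of_mul_pos_right (h1 ▸ htpos 0) hs.le
    linarith
  · obtain ⟨h1, h2, h3, h4⟩ := h n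
    rw [h1, h2, h3, h4]
    simp only [bracketLin, bracket_one_left, one_pow, inv_one]
    push_cast
    refine ⟨?_, ?_, ?_, ?_⟩ <;> field_simp <;> ring

theorem IsBracketType.exists_isJacobiType
    (h : IsBracketType lam nu 1 d₀ d₁ n₀ n₁ ρ ε₀ ε₁)
    (ht : StrictMono t) (htpos : ∀ k, 0 < t k) (hd : d₁ ≠ 0)
    (hD1 : ∀ n, 0 < bracketLin 1 d₀ d₁ 1 * bracketLin 1 d₀ d₁ (2 * n + 1))
    (hDne : ∀ k, k ≠ 0 → bracketLin 1 d₀ d₁ k ≠ 0)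
    (hrel : ∀ k, bracketLin 1 n₀ n₁ (k + 1) = t k * bracketLin 1 d₀ d₁ (k + 1)) :
    ∃ a b s κ : ℝ, 0 < s ∧ κ ≠ 0 ∧ -2 < b ∧ b < a ∧
      IsJacobiType lam nu a b s κ ρ ε₀ ε₁ := by
  simp only [bracketLin, bracket_one_left] at hrel hD1 hDne
  have hlim : Tendsto t atTop (𝓝 (n₁ / d₁)) := by
    have h0 := tendsto_one_div_add_atTop_nhds_zero_nat (𝕜 := ℝ)
    have h1 := ((h0.const_mul n₀).add_const n₁).div ((h0.const_mul d₀).add_const d₁)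
      (by simpa using hd)
    simp only [mul_zero, zero_add] at h1
    refine h1.congr fun k => ?_
    have hk : (k : ℝ) + 1 ≠ 0 := by positivity
    have h2 := hrel k
    have h3 := hDne (k + 1) (by omega)
    push_cast at h2 h3
    have h4 : n₀ * (1 / ((k : ℝ) + 1)) + n₁ = (n₀ + n₁ * (k + 1)) * (1 / ((k : ℝ) + 1)) := by
      field_simp
    have h5 : d₀ * (1 / ((k : ℝ) + 1)) + d₁ = (d₀ + d₁ * (k + 1)) * (1 / ((k : ℝ) + 1)) := by
      field_simp
    simp only [Pi.div_apply]
    rw [h4, h5, mul_div_mul_right _ _ (one_div_ne_zero hk), h2, mul_div_cancel_right₀ _ h3]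
  have hts : t 0 < n₁ / d₁ := (ht zero_lt_one).trans_le (ht.monotone.ge_of_tendsto hlim 1)
  have hs : 0 < n₁ / d₁ := (htpos 0).trans hts
  have hn1 : n₁ ≠ 0 := by
    rintro rfl
    rw [zero_div] at hs
    exact lt_irrefl _ hs
  have ha : 0 < 2 + 2 * d₀ / d₁ := by
    -- For such `n`, `D(2n+1)` has the sign of `d₁`, hence so has `D(1)`.
    obtain ⟨n, hn⟩ := exists_nat_gt (-(d₀ / d₁))
    have h1 := hD1 n
    push_cast at h1
    have h2 : (d₀ + d₁ * 1) * (d₀ + d₁ * (2 * n + 1)) =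
        (d₁ * d₁) * ((d₀ / d₁ + (2 * n + 1)) * (d₀ / d₁ + 1)) := by field_simp
    rw [h2] at h1
    have h3 := pos_of_mul_pos_right h1 (mul_self_nonneg d₁)
    have hn0 : (0 : ℝ) ≤ n := n.cast_nonneg
    have h4 := pos_of_mul_pos_right h3 (by linarith)
    have h5 : 2 + 2 * d₀ / d₁ = 2 * (d₀ / d₁ + 1) := by ring
    rw [h5]
    linarith
  have e0 : n₁ / d₁ * (2 + 2 * n₀ / n₁) = t 0 * (2 + 2 * d₀ / d₁) := by
    have h0 := hrel 0
    push_cast at h0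
    field_simp
    linear_combination h0
  refine ⟨2 * d₀ / d₁, 2 * n₀ / n₁, n₁ / d₁, -(d₁ / 4), hs,
    neg_ne_zero.2 (div_ne_zero hd four_ne_zero), ?_, ?_, fun n => ?_⟩
  · have h1 := pos_of_mul_pos_right (e0 ▸ mul_pos (htpos 0) ha) hs.le
    linarith
  · have h1 : n₁ / d₁ * (2 + 2 * n₀ / n₁) < n₁ / d₁ * (2 + 2 * d₀ / d₁) :=
      e0 ▸ mul_lt_mul_of_pos_right hts ha
    have h2 := lt_of_mul_lt_mul_left h1 hs.le
    linarith
  · obtain ⟨h1, h2, h3, h4⟩ := h n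
    rw [h1, h2, h3, h4]
    simp only [bracketLin, bracket_one_left, one_pow, inv_one]
    push_cast
    refine ⟨?_, ?_, ?_, ?_⟩ <;> field_simp <;> ring

theorem IsMonicEigenfamily.classification (hP : IsMonicEigenfamily L lam P)
    (hL : ActsOnMonomials L lam nu) (hlam : ∀ n m : ℕ, n ≠ m → lam n ≠ lam m)
    (hnu0 : nu 0 = 0) (hnu1 : nu 1 = 0) (hnu : ∀ n : ℕ, 2 ≤ n → nu n ≠ 0)
    (hops : IsPositiveDefiniteOPS P) :
    (∃ q a b s κ ρ ε₀ ε₁ : ℝ, 0 < q ∧ q < 1 ∧ 0 < s ∧ κ ≠ 0 ∧ ρ ≠ 0 ∧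
      -(q ^ 2)⁻¹ < b ∧ b ≤ 0 ∧ b < a ∧
      IsLittleQJacobiType lam nu q a b s κ ρ ε₀ ε₁) ∨
    (∃ q b s κ ρ ε₀ ε₁ : ℝ, 0 < q ∧ q < 1 ∧ 0 < s ∧ κ ≠ 0 ∧ ρ ≠ 0 ∧
      -(q ^ 2)⁻¹ < b ∧
      IsQLaguerreType lam nu q b s κ ρ ε₀ ε₁) ∨
    (∃ a b s κ ρ ε₀ ε₁ : ℝ, 0 < s ∧ κ ≠ 0 ∧ ρ ≠ 0 ∧ -2 < b ∧ b < a ∧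
      IsJacobiType lam nu a b s κ ρ ε₀ ε₁) ∨
    (∃ b s κ ρ ε₀ ε₁ : ℝ, 0 < s ∧ κ ≠ 0 ∧ ρ ≠ 0 ∧ -2 < b ∧
      IsLaguerreType lam nu b s κ ρ ε₀ ε₁) := by
  obtain ⟨σ, hpos, hσ⟩ := hops
  have ht := hpos.moment_ratio_strictMono
  have hm := hpos.moment_pos
  have htpos : ∀ k, 0 < σ (X ^ (2 * (k + 1))) / σ (X ^ (2 * k)) :=
    fun k => div_pos (hm _) (hm _)
  have he : ∀ i j k, i + j = k + 1 → nu (2 * i) - nu (2 * j) =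
      -(σ (X ^ (2 * (k + 1))) / σ (X ^ (2 * k))) * (lam (2 * i) - lam (2 * j)) :=
    fun i j k hk => by
      have h1 := hP.moment_relation_even hσ hL hnu0 hnu1 i j k hk
      have h2 := (hm k).ne'
      field_simp
      linear_combination h1
  have ho : ∀ i j, nu (2 * i + 1) - nu (2 * j + 1) =
      -(σ (X ^ (2 * (i + j + 1))) / σ (X ^ (2 * (i + j)))) *
        (lam (2 * i + 1) - lam (2 * j + 1)) := fun i j => by
    have h1 := hP.moment_relation_odd hσ hL hnu0 hnu1 i j
    have h2 := (hm (i + j)).ne'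
    field_simp
    linear_combination h1
  obtain ⟨θ, d₀, d₁, n₀, n₁, ρ, ε₀, ε₁, hθ, hθ1, hB⟩ :=
    exists_isBracketType ht hlam hnu0 hnu1 he ho
  have hρ := hB.rho_ne_zero hnu
  have hDne : ∀ k, k ≠ 0 → bracketLin θ d₀ d₁ k ≠ 0 := fun k hk => hB.den_ne_zero hlam hk
  have hD1 := hB.den_mul_pos hθ ht hlam he
  have hrel := hB.num_eq hθ he
  rcases hθ1.lt_or_eq with hlt | rfl
  · obtain ⟨q, hq, rfl⟩ : ∃ q : ℝ, 0 < q ∧ q ^ 2 = θ :=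
      ⟨√θ, Real.sqrt_pos.2 hθ, Real.sq_sqrt hθ.le⟩
    have hq1 : q < 1 := by nlinarith
    obtain ⟨A, B, hD⟩ := exists_bracketLin_eq hlt.ne d₀ d₁
    obtain ⟨A', B', hN⟩ := exists_bracketLin_eq hlt.ne n₀ n₁
    rcases eq_or_ne A 0 with rfl | hA
    · right; left
      exact hB.exists_isQLaguerreType hq hq1 ht htpos hρ (hDne 1 one_ne_zero)
        (fun k => by rw [hD, zero_add]) hN hrel
    · left
      obtain ⟨a, b, s, κ, hs, hκ, ha, hb, hba, hT⟩ := hB.exists_isLittleQJacobiType hq hq1 ht htpos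
        hA (hDne 1 one_ne_zero) hD hN hD1 hDne hrel
      exact ⟨q, a, b, s, κ, ρ, ε₀, ε₁, hq, hq1, hs, hκ, hρ, hb,
        hT.nonpos_of_isPositiveDefiniteFunctional hq hq1 hs ha hL hlam hnu0 hnu1 hnu hP hσ hpos,
        hba, hT⟩
  · rcases eq_or_ne d₁ 0 with rfl | hd
    · right; right; right
      obtain ⟨b, s, κ, hs, hκ, hb, hT⟩ := hB.exists_isLaguerreType ht htpos
        (fun h0 => hDne 1 one_ne_zero (by simp [bracketLin, h0])) hrel
      exact ⟨b, s, κ, ρ, ε₀, ε₁, hs, hκ, hρ, hb, hT⟩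
    · right; right; left
      obtain ⟨a, b, s, κ, hs, hκ, hb, hba, hT⟩ := hB.exists_isJacobiType ht htpos hd hD1 hDne hrel
      exact ⟨a, b, s, κ, ρ, ε₀, ε₁, hs, hκ, hρ, hb, hba, hT⟩

end Necessity

/-! ### Exclusion of the little `-1` Jacobi form -/

section LittleNegOneJacobi

variable {L : ℝ[X] →ₗ[ℝ] ℝ[X]} {lam nu : ℕ → ℝ} {P : ℕ → ℝ[X]} {σ : ℝ[X] →ₗ[ℝ] ℝ}
  {f g f' g' t : ℕ → ℝ}

/-- The chords 0–2 and 1–3 are both parallel to `(α₂, β₂)`, so `t 3 = t 1`. The odd relations then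
give `t 2 = t 1`, the chord 0–3 puts `(α₁, β₁)` in the same direction, and the chord 0–1 yields `t 0
= t 1`. -/
theorem not_isLittleNegOneJacobiForm_even (hf : f.Injective) (hf' : f'.Injective)
    (he : ∀ i j k, i + j = k + 1 → g i - g j = -t k * (f i - f j))
    (ho : ∀ i j, g' i - g' j = -t (i + j) * (f' i - f' j)) (ht : t 0 ≠ t 1) :
    ¬ IsLittleNegOneJacobiForm f g := by
  rintro ⟨α₀, α₁, α₂, β₀, β₁, β₂, h⟩
  have f0 := (h 0).1
  have f1 := (h 1).1
  have f2 := (h 2).1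
  have f3 := (h 3).1
  have g0 := (h 0).2
  have g1 := (h 1).2
  have g2 := (h 2).2
  have g3 := (h 3).2
  norm_num at f0 f1 f2 f3 g0 g1 g2 g3
  have hα : α₂ ≠ 0 := fun h0 => hf.ne (show 2 ≠ 0 by omega) (by rw [f2, f0, h0]; ring)
  have hβ : β₂ = -t 1 * α₂ := by
    have := he 2 0 1 rfl
    rw [f2, f0, g2, g0] at this
    linear_combination this / 2
  have h3 : t 3 = t 1 := by
    have := he 3 1 3 rfl
    rw [f3, f1, g3, g1, hβ] at this
    apply mul_left_cancel₀ hα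
    linear_combination -this / 2
  have h2 : t 2 = t 1 := by
    have a1 := ho 1 0
    have a2 := ho 2 1
    have a3 := ho 2 0
    norm_num at a1 a2 a3
    rw [h3] at a2
    apply mul_left_cancel₀ (sub_ne_zero.2 (hf'.ne (show 2 ≠ 0 by omega)))
    linear_combination a3 - a1 - a2
  have hβ1 : β₁ = -t 1 * α₁ := by
    have := he 3 0 2 rfl
    rw [f3, f0, g3, g0, hβ, h2] at this
    linear_combination -this / 2
  have := he 1 0 0 rfl
  have hne := sub_ne_zero.2 (hf.ne (show 1 ≠ 0 by omega))
  apply ht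
  apply mul_left_cancel₀ hne
  have e : g 1 - g 0 = -t 1 * (f 1 - f 0) := by rw [f1, f0, g1, g0, hβ, hβ1]; ring
  linear_combination this - e

/-- Now the chords 0–2 and 1–3 of the odd points give `t 4 = t 2`. The even chords 0–3, 1–2 and 2–3
are then parallel, so four even points are collinear and `t 0 = t 1 = t 2`. -/
theorem not_isLittleNegOneJacobiForm_odd (hf : f.Injective) (hf' : f'.Injective)
    (he : ∀ i j k, i + j = k + 1 → g i - g j = -t k * (f i - f j))
    (ho : ∀ i j, g' i - g' j = -t (i + j) * (f' i - f' j)) (ht : t 0 ≠ t 1) :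
    ¬ IsLittleNegOneJacobiForm f' g' := by
  rintro ⟨α₀, α₁, α₂, β₀, β₁, β₂, h⟩
  have f0 := (h 0).1
  have f1 := (h 1).1
  have f2 := (h 2).1
  have f3 := (h 3).1
  have g0 := (h 0).2
  have g1 := (h 1).2
  have g2 := (h 2).2
  have g3 := (h 3).2
  norm_num at f0 f1 f2 f3 g0 g1 g2 g3
  have hα : α₂ ≠ 0 := fun h0 => hf'.ne (show 2 ≠ 0 by omega) (by rw [f2, f0, h0]; ring)
  have hβ : β₂ = -t 2 * α₂ := by
    have := ho 2 0
    rw [f2, f0, g2, g0] at this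
    linear_combination this / 2
  have h4 : t 4 = t 2 := by
    have := ho 3 1
    rw [f3, f1, g3, g1, hβ] at this
    norm_num at this
    apply mul_left_cancel₀ hα
    linear_combination -this / 2
  have a1 := he 3 0 2 rfl
  have a2 := he 2 1 2 rfl
  have a3 := he 3 2 4 rfl
  rw [h4] at a3
  have h0 : t 0 = t 2 := by
    have := he 1 0 0 rfl
    apply mul_left_cancel₀ (sub_ne_zero.2 (hf.ne (show 1 ≠ 0 by omega)))
    linear_combination this - a1 + a2 + a3
  have h1 : t 1 = t 2 := by
    have := he 2 0 1 rfl
    apply mul_left_cancel₀ (sub_ne_zero.2 (hf.ne (show 2 ≠ 0 by omega)))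
    linear_combination this - a1 + a3
  exact ht (h0.trans h1.symm)

theorem IsMonicEigenfamily.not_isLittleNegOneJacobiForm (hP : IsMonicEigenfamily L lam P)
    (hL : ActsOnMonomials L lam nu) (hlam : ∀ n m : ℕ, n ≠ m → lam n ≠ lam m)
    (hnu0 : nu 0 = 0) (hnu1 : nu 1 = 0) (hnu : ∀ n : ℕ, 2 ≤ n → nu n ≠ 0) (hops : IsOPS P) :
    ¬ IsLittleNegOneJacobiForm (fun n => lam (2 * n)) (fun n => nu (2 * n)) ∧
      ¬ IsLittleNegOneJacobiForm (fun n => lam (2 * n + 1)) (fun n => nu (2 * n + 1)) := by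
  obtain ⟨σ, hdet, hσ⟩ := hops
  have hrel := hP.moment_relation hσ hL hnu0 hnu1
  -- If `c_{2k+2} = 0`, the moment relation would give `ν_{2k+2} c_{2k} = 0`.
  have hm : ∀ k, σ (X ^ (2 * k)) ≠ 0 := fun k => by
    induction k with
    | zero => simpa using hdet 0
    | succ k ih =>
      intro h0
      have e := hP.moment_relation_even hσ hL hnu0 hnu1 (k + 1) 0 k rfl
      rw [h0, mul_zero, zero_add, mul_zero, hnu0, sub_zero] at e
      exact (mul_ne_zero (hnu _ (by omega)) ih) e
  have hm1 : σ X = 0 := by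
    have := hσ 1 0 one_ne_zero
    rwa [hP.one_eq hL hlam hnu0 hnu1, hP.zero_eq, mul_one] at this
  have hm3 : σ (X ^ 3) = 0 := by
    have e := hrel 3 0
    norm_num [hm1] at e
    exact e.resolve_left (sub_ne_zero.2 (hlam 3 0 (by omega)))
  -- With `c_1 = c_3 = 0` the third Hankel determinant is `c_2 (c_0 c_4 - c_2²)`.
  have ht : σ (X ^ (2 * (0 + 1))) / σ (X ^ (2 * 0)) ≠ σ (X ^ (2 * (1 + 1))) / σ (X ^ (2 * 1)) := by
    intro h
    rw [div_eq_div_iff (hm 0) (hm 1)] at h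
    apply hdet 2
    rw [Matrix.det_fin_three]
    norm_num [hm1, hm3] at h ⊢
    linear_combination (-σ (X ^ 2)) * h
  have he : ∀ i j k, i + j = k + 1 → nu (2 * i) - nu (2 * j) =
      -(σ (X ^ (2 * (k + 1))) / σ (X ^ (2 * k))) * (lam (2 * i) - lam (2 * j)) :=
    fun i j k hk => by
      have h1 := hP.moment_relation_even hσ hL hnu0 hnu1 i j k hk
      have h2 := hm k
      field_simp
      linear_combination h1
  have ho : ∀ i j, nu (2 * i + 1) - nu (2 * j + 1) =
      -(σ (X ^ (2 * (i + j + 1))) / σ (X ^ (2 * (i + j)))) *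
        (lam (2 * i + 1) - lam (2 * j + 1)) := fun i j => by
    have h1 := hP.moment_relation_odd hσ hL hnu0 hnu1 i j
    have h2 := hm (i + j)
    field_simp
    linear_combination h1
  have hf : (fun n => lam (2 * n)).Injective := fun i j hij => by
    by_contra hne
    exact hlam _ _ (by omega) hij
  have hf' : (fun n => lam (2 * n + 1)).Injective := fun i j hij => by
    by_contra hne
    exact hlam _ _ (by omega) hij
  exact ⟨not_isLittleNegOneJacobiForm_even (t := fun k => σ (X ^ (2 * (k + 1))) / σ (X ^ (2 * k)))
      hf hf' he ho ht,
    not_isLittleNegOneJacobiForm_odd (t := fun k => σ (X ^ (2 * (k + 1))) / σ (X ^ (2 * k)))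
      hf hf' he ho ht⟩

end LittleNegOneJacobi

/-! ### The main theorem -/

theorem mainTheorem1
    (L : ℝ[X] →ₗ[ℝ] ℝ[X]) (lam nu : ℕ → ℝ)
    (hL : ActsOnMonomials L lam nu)
    (hlam : ∀ n m : ℕ, n ≠ m → lam n ≠ lam m)
    (hnu0 : nu 0 = 0) (hnu1 : nu 1 = 0) (hnu : ∀ n : ℕ, 2 ≤ n → nu n ≠ 0) :
    (∃! P : ℕ → ℝ[X], IsMonicEigenfamily L lam P) ∧
    ∀ P : ℕ → ℝ[X], IsMonicEigenfamily L lam P →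
      IsSymmetricFamily P ∧
      (IsPositiveDefiniteOPS P ↔
        (∃ q a b s κ ρ ε₀ ε₁ : ℝ, 0 < q ∧ q < 1 ∧ 0 < s ∧ κ ≠ 0 ∧ ρ ≠ 0 ∧
          -(q ^ 2)⁻¹ < b ∧ b ≤ 0 ∧ b < a ∧
          IsLittleQJacobiType lam nu q a b s κ ρ ε₀ ε₁) ∨
        (∃ q b s κ ρ ε₀ ε₁ : ℝ, 0 < q ∧ q < 1 ∧ 0 < s ∧ κ ≠ 0 ∧ ρ ≠ 0 ∧
          -(q ^ 2)⁻¹ < b ∧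
          IsQLaguerreType lam nu q b s κ ρ ε₀ ε₁) ∨
        (∃ a b s κ ρ ε₀ ε₁ : ℝ, 0 < s ∧ κ ≠ 0 ∧ ρ ≠ 0 ∧ -2 < b ∧ b < a ∧
          IsJacobiType lam nu a b s κ ρ ε₀ ε₁) ∨
        (∃ b s κ ρ ε₀ ε₁ : ℝ, 0 < s ∧ κ ≠ 0 ∧ ρ ≠ 0 ∧ -2 < b ∧
          IsLaguerreType lam nu b s κ ρ ε₀ ε₁)) ∧
      (∀ q a b s κ ρ ε₀ ε₁ : ℝ, 0 < q → q < 1 →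
        IsLittleQJacobiType lam nu q a b s κ ρ ε₀ ε₁ →
        HasSymmetricRecurrence P
          (fun n => s * uQJacobiEven q a b n) (fun n => s * uQJacobiOdd q a b n)) ∧
      (∀ q b s κ ρ ε₀ ε₁ : ℝ, 0 < q → q < 1 →
        IsQLaguerreType lam nu q b s κ ρ ε₀ ε₁ →
        HasSymmetricRecurrence P
          (fun n => s * uQLaguerreEven q n) (fun n => s * uQLaguerreOdd q b n)) ∧
      (∀ a b s κ ρ ε₀ ε₁ : ℝ,
        IsJacobiType lam nu a b s κ ρ ε₀ ε₁ →
        HasSymmetricRecurrence P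
          (fun n => s * uJacobiEven a b n) (fun n => s * uJacobiOdd a b n)) ∧
      (∀ b s κ ρ ε₀ ε₁ : ℝ,
        IsLaguerreType lam nu b s κ ρ ε₀ ε₁ →
        HasSymmetricRecurrence P
          (fun n => s * uLaguerreEven n) (fun n => s * uLaguerreOdd b n)) ∧
      (IsOPS P →
        ¬ IsLittleNegOneJacobiForm (fun n => lam (2 * n)) (fun n => nu (2 * n)) ∧
        ¬ IsLittleNegOneJacobiForm (fun n => lam (2 * n + 1)) (fun n => nu (2 * n + 1))) := by
  refine ⟨existsUnique_isMonicEigenfamily hL hlam hnu0 hnu1, fun P hP =>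
    ⟨hP.symmetric hL hlam hnu0 hnu1,
      ⟨hP.classification hL hlam hnu0 hnu1 hnu, ?_⟩, ?_, ?_, ?_, ?_,
      hP.not_isLittleNegOneJacobiForm hL hlam hnu0 hnu1 hnu⟩⟩
  · rintro (⟨q, a, b, s, κ, ρ, ε₀, ε₁, hq, hq1, hs, -, -, hb, hb0, hba, h⟩ |
      ⟨q, b, s, κ, ρ, ε₀, ε₁, hq, hq1, hs, -, -, hb, h⟩ |
      ⟨a, b, s, κ, ρ, ε₀, ε₁, hs, -, -, hb, hba, h⟩ | ⟨b, s, κ, ρ, ε₀, ε₁, hs, -, -, hb, h⟩)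
    · exact h.isPositiveDefiniteOPS hq hq1 hs hb hb0 hba hL hlam hnu0 hnu1 hnu hP
    · exact h.isPositiveDefiniteOPS hq hq1 hs hb hL hlam hnu0 hnu1 hnu hP
    · exact h.isPositiveDefiniteOPS hs hb hba hL hlam hnu0 hnu1 hnu hP
    · exact h.isPositiveDefiniteOPS hs hb hL hlam hnu0 hnu1 hnu hP
  · intro q a b s κ ρ ε₀ ε₁ hq hq1 h
    exact h.hasSymmetricRecurrence hq hq1 hL hlam hnu0 hnu1 hnu hP
  · intro q b s κ ρ ε₀ ε₁ hq hq1 h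
    exact h.hasSymmetricRecurrence hq hq1 hL hlam hnu0 hnu1 hnu hP
  · intro a b s κ ρ ε₀ ε₁ h
    exact h.hasSymmetricRecurrence hL hlam hnu0 hnu1 hnu hP
  · intro b s κ ρ ε₀ ε₁ h
    exact h.hasSymmetricRecurrence hL hlam hnu0 hnu1 hnu hP
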